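/- Let $G$ be a compact Hausdorff group (for instance a compact Lie group), let $\mathcal A$ be a unital C$^*$-algebra with an action $\alpha$ of $G$ by $^*$-automorphisms such that $(g,x)\mapsto\alpha_g(x)$ is continuous, and let $\mathcal B:=\mathcal A^G$ be the fixed point algebra. Representations of $G$ are continuous, unitary and finite-dimensional. Fix a complete set $\operatorname{Irrep}(G)$ of representatives of the irreducible representations $(\sigma,V_\sigma)$ and, for each of them, a finite-dimensional Hilbert space $H_\sigma$ and an element $s(\sigma)\in\mathcal A\otimes\operatorname{End}(V_\sigma,H_\sigma)$ with $s(\sigma)^*s(\sigma)=1$ and $\alpha_g(s(\sigma))=s(\sigma)(1\otimes\sigma_g)$ for all $g\in G$, where $H_1=\mathbb C$ and $s(1)=1_{\mathcal A}$ for the trivial representation $1$. (Such a family exists exactly when the action is free.) For an arbitrary finite-dimensional representation $\sigma$, choose a decomposition $\sigma=\sigma_1\oplus\dots\oplus\sigma_n$ into irreducible subrepresentations, each identified with its representative, and put $H_\sigma:=H_{\sigma_1}\oplus\dots\oplus H_{\sigma_n}$ and $s(\sigma):=s(\sigma_1)\oplus\dots\oplus s(\sigma_n)$. For $b\in\mathcal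 B$ define $$\gamma_\sigma(b):=s(\sigma)(b\otimes 1)s(\sigma)^*,\qquad \omega(\sigma,\tau):=s(\sigma\otimes\tau)\,s(\sigma)^*s(\tau)^*,$$ where $s(\sigma)$ and $s(\tau)$ are amplified to act trivially on the other tensor leg. These lie in $\mathcal B\otimes\operatorname{End}(H_\sigma)$ and $\mathcal B\otimes\operatorname{End}(H_\sigma\otimes H_\tau,H_{\sigma\otimes\tau})$. Let $\bar V_\sigma$ be the conjugate space of $V_\sigma$, carrying the conjugate representation $\bar\sigma$, and for $x\in\mathcal B\otimes H_\sigma\otimes\bar V_\sigma$ define $a_\sigma(x)\in\mathcal A$ linearly by $a_\sigma(b\otimes\eta\otimes\bar v):=(\mathrm{id}\otimes\langle v,\cdot\rangle)\bigl(s(\sigma)^*(b\otimes\eta)\bigr)$. Let $\mathcal B_0\subseteq\mathcal B$ be a dense unital $^*$-subalgebra such that for all $\sigma,\tau\in\operatorname{Irrep}(G)$ $$\gamma_\sigma(\mathcal B_0)\subseteq\mathcal B_0\otimes\operatorname{End}(H_\sigma),\qquad \omega(\sigma,\tau)\in\mathcal B_0\otimes\operatorname{End}(H_\sigma\otimes H_\tau,H_{\sigma\otimes\tau}).$$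 Then the set $$\mathcal A_0:=\{a_\sigma(x):\ \sigma\text{ a finite-dimensional representation of }G,\ x\in\mathcal B_0\otimes H_\sigma\otimes\bar V_\sigma\}$$ is a dense, $G$-invariant unital $^*$-subalgebra of $\mathcal A$, and $\mathcal A_0^G=\mathcal A_0\cap\mathcal B=\mathcal B_0$. Moreover, for all finite-dimensional representations $\sigma,\tau$, all $g\in G$, $b,c\in\mathcal B$, $\eta\in H_\sigma$, $\vartheta\in H_\tau$, $v\in V_\sigma$, $w\in V_\tau$ and $x\in\mathcal B\otimes H_\sigma$: 1. $\alpha_g\bigl(a_\sigma(b\otimes\eta\otimes\bar v)\bigr)=a_\sigma(b\otimes\eta\otimes\bar\sigma_g\bar v)$. 2. $a_\sigma(b\otimes\eta\otimes\bar v)\,a_\tau(c\otimes\vartheta\otimes\bar w)=a_{\sigma\otimes\tau}\bigl(\omega(\sigma,\tau)\,\gamma_\tau(b)_{13}\,(c\otimes\eta\otimes\vartheta)\otimes\bar v\otimes\bar w\bigr)$, where $\gamma_\tau(b)_{13}$ acts on the legs $\mathcal B$ and $H_\tau$. The element $\omega(\sigma,\tau)\gamma_\tau(b)_{13}(c\otimes\eta\otimes\vartheta)$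 lies in $\mathcal B\otimes H_{\sigma\otimes\tau}$, and in $\mathcal B_0\otimes H_{\sigma\otimes\tau}$ if $b,c\in\mathcal B_0$. 3. $a_\sigma(x\otimes\bar v)^*=a_{\bar\sigma}\bigl(J_\sigma(x)\otimes v\bigr)$, where $J_\sigma:\mathcal B\otimes H_\sigma\to\mathcal B\otimes H_{\bar\sigma}$ is the antilinear map $$J_\sigma(b\otimes\eta)=\gamma_{\bar\sigma}(b^*)\,(\langle\eta,\cdot\rangle\otimes 1)\,\omega(\sigma,\bar\sigma)^*(1\otimes r_\sigma).$$ Here, for an orthonormal basis $(e_i)$ of $V_\sigma$, $r_\sigma\in H_{\sigma\otimes\bar\sigma}$ is the vector obtained from the $G$-invariant vector $\sum_i e_i\otimes\bar e_i\in V_\sigma\otimes\bar V_\sigma$, which lies in the sum of the trivial summands of $\sigma\otimes\bar\sigma$, by replacing each trivial summand $\mathbb C$ by the corresponding copy of $H_1=\mathbb C$ in $H_{\sigma\otimes\bar\sigma}$. Furthermore $J_\sigma(\mathcal B_0\otimes H_\sigma)\subseteq\mathcal B_0\otimes H_{\bar\sigma}$. -/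

import Mathlib

open Matrix Topology
open scoped Kronecker ComplexConjugate

/-- A continuous action of `G` on the unital C*-algebra `A` by *-automorphisms, i.e. a
C*-dynamical system: `(g, a) ↦ α_g(a)` is jointly continuous. -/
structure CStarAction (G : Type*) [Group G] [TopologicalSpace G] (A : Type*) [CStarAlgebra A] where
  toHom : G →* (A ≃⋆ₐ[ℂ] A)
  continuous_act : Continuous fun p : G × A => toHom p.1 p.2

/-- The fixed point algebra `A^G`. -/
def CStarAction.fixed {G : Type*} [Group G] [TopologicalSpace G] {A : Type*} [CStarAlgebra A]
    (α : CStarAction G A) : StarSubalgebra ℂ A where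
  carrier := {a | ∀ g, α.toHom g a = a}
  mul_mem' {a b} ha hb g := by rw [map_mul, ha g, hb g]
  one_mem' g := map_one _
  add_mem' {a b} ha hb g := by rw [map_add, ha g, hb g]
  zero_mem' g := map_zero _
  algebraMap_mem' r g := by
    rw [Algebra.algebraMap_eq_smul_one, map_smul, map_one]
  star_mem' {a} ha g := by rw [map_star, ha g]

/-- A finite-dimensional continuous unitary representation of `G`. The representation space is
written in an orthonormal basis indexed by the finite type `ι`, so that `V = ℂ^ι`. Dimension zero
is allowed. -/
structure FinUnitaryRep (G : Type*) [Group G] [TopologicalSpace G] where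
  ι : Type
  [fintypeι : Fintype ι]
  [decEqι : DecidableEq ι]
  hom : G →* Matrix.unitaryGroup ι ℂ
  continuous_hom : Continuous hom

attribute [instance] FinUnitaryRep.fintypeι FinUnitaryRep.decEqι

namespace FinUnitaryRep

variable {G : Type*} [Group G] [TopologicalSpace G]

/-- The unitary matrix `σ_g`. -/
def mat (σ : FinUnitaryRep G) (g : G) : Matrix σ.ι σ.ι ℂ := (σ.hom g : Matrix σ.ι σ.ι ℂ)

theorem continuous_mat (σ : FinUnitaryRep G) : Continuous σ.mat :=
  continuous_subtype_val.comp σ.continuous_hom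

theorem mat_mul (σ : FinUnitaryRep G) (g h : G) : σ.mat (g * h) = σ.mat g * σ.mat h := by
  simp [mat]

theorem mat_one (σ : FinUnitaryRep G) : σ.mat 1 = 1 := by simp [mat]

theorem mat_mem (σ : FinUnitaryRep G) (g : G) : σ.mat g ∈ Matrix.unitaryGroup σ.ι ℂ := (σ.hom g).2

/-- Irreducibility: the space is nonzero and has no invariant subspaces besides `0` and itself. -/
def IsIrred (σ : FinUnitaryRep G) : Prop :=
  Nonempty σ.ι ∧ ∀ W : Submodule ℂ (σ.ι → ℂ),
    (∀ g, ∀ w ∈ W, σ.mat g *ᵥ w ∈ W) → W = ⊥ ∨ W = ⊤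

/-- Unitary equivalence of representations. -/
def Equivalent (σ τ : FinUnitaryRep G) : Prop :=
  ∃ U : Matrix τ.ι σ.ι ℂ, Uᴴ * U = 1 ∧ U * Uᴴ = 1 ∧ ∀ g, U * σ.mat g = τ.mat g * U

/-- The tensor product `σ ⊗ τ` on `V_σ ⊗ V_τ`, in the product basis. -/
abbrev tensor (σ τ : FinUnitaryRep G) : FinUnitaryRep G where
  ι := σ.ι × τ.ι
  hom :=
    { toFun := fun g => ⟨σ.mat g ⊗ₖ τ.mat g,
        Matrix.kronecker_mem_unitary (σ.mat_mem g) (τ.mat_mem g)⟩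
      map_one' := by
        apply Subtype.ext
        simp [mat_one]
      map_mul' := fun g h => by
        apply Subtype.ext
        simp [mat_mul, Matrix.mul_kronecker_mul] }
  continuous_hom := by
    refine Continuous.subtype_mk (continuous_matrix fun i j => ?_) _
    exact (σ.continuous_mat.matrix_elem i.1 j.1).mul (τ.continuous_mat.matrix_elem i.2 j.2)

/-- The conjugate representation on the conjugate space `V̄_σ`, in the conjugate basis: its
matrices are the entrywise complex conjugates. -/
abbrev conjRep (σ : FinUnitaryRep G) : FinUnitaryRep G where
  ι := σ.ι
  hom :=
    { toFun := fun g => ⟨(σ.mat g).map (starRingEnd ℂ), by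
        rw [Matrix.mem_unitaryGroup_iff]
        have h := Matrix.mem_unitaryGroup_iff.1 (σ.mat_mem g)
        have h2 := congrArg (fun M => M.map (starRingEnd ℂ)) h
        simp only [Matrix.map_mul] at h2
        rw [Matrix.map_one _ (map_zero _) (map_one _)] at h2
        rw [← h2]
        congr 1⟩
      map_one' := by
        apply Subtype.ext
        simp [mat_one]
      map_mul' := fun g h => by
        apply Subtype.ext
        simp [mat_mul, Matrix.map_mul] }
  continuous_hom := by
    refine Continuous.subtype_mk (continuous_matrix fun i j => ?_) _
    exact Complex.continuous_conj.comp (σ.continuous_mat.matrix_elem i j)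

end FinUnitaryRep

/-- A complete set of representatives for the equivalence classes of irreducible representations
of `G`; the class of the trivial representation is represented by the trivial representation on a
one-dimensional space. -/
structure IrrepSystem (G : Type*) [Group G] [TopologicalSpace G] where
  Idx : Type*
  rep : Idx → FinUnitaryRep G
  irred : ∀ i, (rep i).IsIrred
  complete : ∀ σ : FinUnitaryRep G, σ.IsIrred → ∃ i, σ.Equivalent (rep i)
  inequivalent : ∀ i j, (rep i).Equivalent (rep j) → i = j
  one : Idx
  card_one : Fintype.card (rep one).ι = 1
  mat_one : ∀ g, (rep one).mat g = 1

/-- The isometries `s(σ) ∈ A ⊗ End(V_σ, H_σ)`, for irreducible `σ`. Here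
`H_σ = ℂ^(κ σ)` is a finite-dimensional Hilbert space, `A ⊗ End(V_σ, H_σ)` is the space of
`κ σ × ι` matrices over `A`, and `s(σ)` satisfies `s(σ)* s(σ) = 1` and
`α_g(s(σ)) = s(σ) (1 ⊗ σ_g)`. The choice is normalized by `H_1 = ℂ` and `s(1) = 1_A`. -/
structure IsometrySystem {G : Type*} [Group G] [TopologicalSpace G] {A : Type*} [CStarAlgebra A]
    (α : CStarAction G A) (I : IrrepSystem G) where
  κ : I.Idx → Type
  [fintypeκ : ∀ i, Fintype (κ i)]
  [decEqκ : ∀ i, DecidableEq (κ i)]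
  s : ∀ i, Matrix (κ i) (I.rep i).ι A
  isometry : ∀ i, (s i)ᴴ * s i = 1
  equivariant : ∀ i g, (s i).map (α.toHom g) = s i * ((I.rep i).mat g).map (algebraMap ℂ A)
  card_one : Fintype.card (κ I.one) = 1
  s_one : ∀ a v, s I.one a v = 1

attribute [instance] IsometrySystem.fintypeκ IsometrySystem.decEqκ

/-- A decomposition `σ = σ_1 ⊕ ⋯ ⊕ σ_n` of a finite-dimensional representation into irreducible
subrepresentations, each identified with its representative; it is recorded as a unitary
intertwiner `U` from `V_σ` onto the direct sum of the representatives. -/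
structure Decomposition {G : Type*} [Group G] [TopologicalSpace G] (I : IrrepSystem G)
    (σ : FinUnitaryRep G) where
  n : ℕ
  idx : Fin n → I.Idx
  U : Matrix (Σ k, (I.rep (idx k)).ι) σ.ι ℂ
  star_mul_self : Uᴴ * U = 1
  mul_star_self : U * Uᴴ = 1
  intertwines : ∀ g, U * σ.mat g = Matrix.blockDiagonal' (fun k => (I.rep (idx k)).mat g) * U

section FactorSystem

variable {A : Type*} [CStarAlgebra A]

/-- `s (b ⊗ 1) s*`, an element of `A ⊗ End(H)`, for `s ∈ A ⊗ End(V, H)` and `b ∈ A`. -/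
def coact {κ ι : Type} [Fintype ι] [DecidableEq ι] (s : Matrix κ ι A) (b : A) : Matrix κ κ A :=
  (s * (Matrix.diagonal (fun _ => b) : Matrix ι ι A) : Matrix κ ι A) * (sᴴ : Matrix ι κ A)

/-- `s(σ ⊗ τ) s(σ)* s(τ)*`, an element of `A ⊗ End(H_σ ⊗ H_τ, H_{σ ⊗ τ})`. The factor
`s(σ)* s(τ)*`, with `s(σ)` and `s(τ)` amplified to act on their own tensor legs, is the matrix
with entries `(s(σ)*)_{i k} (s(τ)*)_{j l}`. -/
def cocyc {κ₁ ι₁ κ₂ ι₂ κ₃ : Type} [Fintype ι₁] [Fintype ι₂]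
    (s₁₂ : Matrix κ₃ (ι₁ × ι₂) A) (s₁ : Matrix κ₁ ι₁ A) (s₂ : Matrix κ₂ ι₂ A) :
    Matrix κ₃ (κ₁ × κ₂) A :=
  s₁₂ * (s₁ᴴ ⊗ₖ s₂ᴴ)

/-- The element `x ⊗ w` of `A ⊗ H ⊗ V̄`, for `x ∈ A ⊗ H` and `w ∈ V̄` with coordinates `w i` in the
conjugate of the standard basis of `V`. In particular, for a vector `v` of `V` the conjugate vector
`v̄` has coordinates `star v`. -/
def tens {κ ι : Type} (x : κ → A) (w : ι → ℂ) : Matrix κ ι A := fun k i => w i • x k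

/-- The element `b ⊗ η` of `A ⊗ H`. -/
def simpleVec {κ : Type} (b : A) (η : κ → ℂ) : κ → A := fun k => η k • b

end FactorSystem

namespace IsometrySystem

variable {G : Type*} [Group G] [TopologicalSpace G] {A : Type*} [CStarAlgebra A]
  {α : CStarAction G A} {I : IrrepSystem G}

/-- The index set of the basis of `H_σ = H_{σ_1} ⊕ ⋯ ⊕ H_{σ_n}`. -/
abbrev Hι (S : IsometrySystem α I) {σ : FinUnitaryRep G} (D : Decomposition I σ) : Type :=
  Σ k, S.κ (D.idx k)

/-- The extension `s(σ) = s(σ_1) ⊕ ⋯ ⊕ s(σ_n)` to a finite-dimensional representation. -/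
noncomputable def ext (S : IsometrySystem α I) {σ : FinUnitaryRep G} (D : Decomposition I σ) :
    Matrix (S.Hι D) σ.ι A :=
  Matrix.blockDiagonal' (fun k => S.s (D.idx k)) * D.U.map (algebraMap ℂ A)

variable (S : IsometrySystem α I) (dec : ∀ σ : FinUnitaryRep G, Decomposition I σ)

/-- The coaction `γ_σ(b) = s(σ) (b ⊗ 1) s(σ)*`. -/
noncomputable def γ (σ : FinUnitaryRep G) (b : A) : Matrix (S.Hι (dec σ)) (S.Hι (dec σ)) A :=
  coact (S.ext (dec σ)) b

/-- The cocycle `ω(σ, τ) = s(σ ⊗ τ) s(σ)* s(τ)*`. -/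
noncomputable def ω (σ τ : FinUnitaryRep G) :
    Matrix (S.Hι (dec (σ.tensor τ))) (S.Hι (dec σ) × S.Hι (dec τ)) A :=
  cocyc (S.ext (dec (σ.tensor τ))) (S.ext (dec σ)) (S.ext (dec τ))

/-- The cocycle `ω(σ, τ)` of a pair of irreducible representations, formed with the originally
given isometries `s(σ)` and `s(τ)`. -/
noncomputable def ωIrr (i j : I.Idx) :
    Matrix (S.Hι (dec ((I.rep i).tensor (I.rep j)))) (S.κ i × S.κ j) A :=
  cocyc (S.ext (dec ((I.rep i).tensor (I.rep j)))) (S.s i) (S.s j)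

/-- `a_σ(x)` for `x ∈ A ⊗ H_σ ⊗ V̄_σ`: the linear extension of
`b ⊗ η ⊗ v̄ ↦ Φ_σ(s(σ)*(b ⊗ η) ⊗ v̄)`, where `Φ_σ` is the contraction `A ⊗ V_σ ⊗ V̄_σ → A`,
`a ⊗ v ⊗ w̄ ↦ ⟨w, v⟩ a`, that is, the trace of the matrix of coordinates. -/
noncomputable def a (σ : FinUnitaryRep G) (x : Matrix (S.Hι (dec σ)) σ.ι A) : A :=
  Matrix.trace ((S.ext (dec σ))ᴴ * x)

/-- The argument `ω(σ, τ) γ_τ(b)₁₃ (c ⊗ η ⊗ ϑ)` in `A ⊗ H_{σ ⊗ τ}`. -/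
noncomputable def mulArg (σ τ : FinUnitaryRep G) (b c : A) (η : S.Hι (dec σ) → ℂ) (ϑ : S.Hι (dec τ) → ℂ) :
    S.Hι (dec (σ.tensor τ)) → A :=
  S.ω dec σ τ *ᵥ (((1 : Matrix (S.Hι (dec σ)) (S.Hι (dec σ)) A) ⊗ₖ S.γ dec τ b) *ᵥ
    simpleVec c (fun p => η p.1 * ϑ p.2))

/-- The image in `H_{σ ⊗ σ̄}` of the invariant vector `∑ e_i ⊗ ē_i` of `V_σ ⊗ V̄_σ` under the
functor `σ ↦ H_σ`: the vector lies in the sum of the trivial (one-dimensional) summands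
of `σ ⊗ σ̄`, and its coordinate there is carried over to the corresponding copy of `H_1 = ℂ`. -/
noncomputable def invVec (σ : FinUnitaryRep G) : S.Hι (dec (σ.tensor σ.conjRep)) → ℂ := by
  classical
  exact fun m =>
    if (dec (σ.tensor σ.conjRep)).idx m.1 = I.one then
      ∑ v, ((dec (σ.tensor σ.conjRep)).U *ᵥ
        (fun p : σ.ι × σ.ι => if p.1 = p.2 then (1 : ℂ) else 0)) ⟨m.1, v⟩
    else 0

/-- The antilinear map `J_σ : A ⊗ H_σ → A ⊗ H_σ̄` of the factor system,
`J_σ(b ⊗ η) = γ_σ̄(b*) (⟨η| ⊗ 1) ω(σ, σ̄)* (1 ⊗ r)`, where `r ∈ H_{σ ⊗ σ̄}` is the vector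
corresponding to the invariant vector `∑ e_i ⊗ ē_i` and `⟨η|` contracts the leg `H_σ`. -/
noncomputable def J (σ : FinUnitaryRep G) :
    (S.Hι (dec σ) → A) →ₛₗ[starRingEnd ℂ] (S.Hι (dec σ.conjRep) → A) where
  toFun x := ∑ k, S.γ dec σ.conjRep (star (x k)) *ᵥ
    fun l => ((S.ω dec σ σ.conjRep)ᴴ *ᵥ simpleVec 1 (S.invVec dec σ)) (k, l)
  map_add' x y := by
    rw [← Finset.sum_add_distrib]
    refine Finset.sum_congr rfl fun k _ => ?_
    rw [← Matrix.add_mulVec]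
    congr 1
    simp only [γ, coact, Pi.add_apply, star_add]
    rw [← Matrix.add_mul, ← Matrix.mul_add, Matrix.diagonal_add]
  map_smul' c x := by
    rw [Finset.smul_sum]
    refine Finset.sum_congr rfl fun k _ => ?_
    rw [← Matrix.smul_mulVec]
    congr 1
    simp only [γ, coact, Pi.smul_apply, star_smul, starRingEnd_apply]
    rw [← Matrix.smul_mul, ← Matrix.mul_smul, ← Matrix.diagonal_smul]
    rfl

end IsometrySystem

/-!
For any representation `σ` the matrix `s(σ)` satisfies `s(σ)* s(σ) = 1` and
`α_g(s(σ)) = s(σ) σ_g`. Since moreover `a_σ(x) = tr(s(σ)* x)`, the formulas for the action, the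
product and the involution are computations with matrices over `A` in which scalar matrices
commute past everything (`act_a`, `a_mul_a`, `star_a`). The involution also uses that `s(σ)` sends
an invariant vector of `V_σ` to a scalar vector of `H_σ` (`ext_mulVec_of_invariant`).

That all coefficients stay in `B₀` rests on Schur's lemma. For an intertwiner `T : ρ' → ρ` and
`b ∈ B₀`, the matrix `s(ρ) (b ⊗ T) s(ρ')*` splits into blocks that are `0` or multiples of
`γ_i(b)` with `i` irreducible, so it is a matrix over `B₀` (`IsCompatible.ext_mul_mem`). With
`T = 1` this handles `γ_σ`. With `b = 1` it compares `ω(σ, τ)` with the cocycles of the irreducible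
summands and moves `a_σ(x)` along `σ → σ ⊕ τ`, which shows that `A₀` is closed under sums. The fixed
point algebra satisfies the same two hypotheses as `B₀`, so each of these statements also holds
with `A^G` in place of `B₀`.

The remaining assertions use the Haar measure. If `a_σ(x)` is invariant, averaging replaces `σ_g` by
a matrix with invariant columns, whence `a_σ(x) ∈ B₀` (`a_mem_of_mem_fixed`). For density,
`a ∈ A` is approximated by `∫ f(g) α_g(a) dg` with `f` concentrated near `1`; by the Peter–Weyl
theorem (`exists_matrixCoefficient_near`) `f` may be taken to be a matrix coefficient
`tr(C σ_g)`, and then the integral is `a_σ(s(σ) Z C)` with `Z = ∫ σ_g ⊗ α_g(a) dg`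
(`exists_a_near`). The Peter–Weyl theorem follows from the Stone–Weierstrass theorem once the
representations separate points, which comes from the spectral theorem for the compact self-adjoint
convolution operators on `L²(G)`, whose eigenspaces for nonzero eigenvalues are finite-dimensional
and invariant under translations (`exists_mat_ne_one`).
-/

/-! ### Matrices with scalar entries -/

section ScalarMatrices

variable {A : Type*} [CStarAlgebra A] {l m n p : Type*}

theorem Matrix.map_algebraMap_mul [Fintype m] (C : Matrix l m ℂ) (D : Matrix m n ℂ) :
    (C * D).map (algebraMap ℂ A) = C.map (algebraMap ℂ A) * D.map (algebraMap ℂ A) :=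
  Matrix.map_mul

theorem Matrix.map_algebraMap_one [DecidableEq m] :
    (1 : Matrix m m ℂ).map (algebraMap ℂ A) = 1 :=
  Matrix.map_one _ (map_zero _) (map_one _)

theorem Matrix.conjTranspose_map_algebraMap (C : Matrix m n ℂ) :
    (C.map (algebraMap ℂ A))ᴴ = Cᴴ.map (algebraMap ℂ A) := by
  ext i j
  simp only [conjTranspose_apply, map_apply]
  rw [algebraMap_star_comm]

/-- The trace is cyclic with respect to scalar matrices. -/
theorem Matrix.trace_mul_map_algebraMap [Fintype m] [Fintype n] (X : Matrix m n A)
    (C : Matrix n m ℂ) :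
    trace (X * C.map (algebraMap ℂ A)) = trace (C.map (algebraMap ℂ A) * X) := by
  simp only [trace, diag, mul_apply, map_apply]
  rw [Finset.sum_comm]
  exact Finset.sum_congr rfl fun i _ => Finset.sum_congr rfl fun j _ =>
    (Algebra.commutes _ _).symm

theorem Matrix.trace_mul_conjTranspose_map_algebraMap [Fintype m] [Fintype n] (X : Matrix m n A)
    (C : Matrix m n ℂ) :
    trace (X * Cᴴ.map (algebraMap ℂ A)) = ∑ i, ∑ j, conj (C i j) • X i j := by
  simp only [trace, diag, Matrix.mul_apply, map_apply, conjTranspose_apply, Algebra.smul_def,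
    Algebra.commutes]
  rfl

theorem Matrix.map_algebraMap_mul_diagonal [Fintype m] [DecidableEq m] [Fintype n] [DecidableEq n]
    (C : Matrix m n ℂ) (b : A) :
    C.map (algebraMap ℂ A) * (diagonal fun _ => b : Matrix n n A) =
      (diagonal fun _ => b : Matrix m m A) * C.map (algebraMap ℂ A) := by
  ext i j
  rw [mul_diagonal, diagonal_mul, map_apply, Algebra.commutes]

theorem Matrix.kronecker_map_algebraMap_mul {l' m' n' : Type*} [Fintype m] [Fintype m']
    (C : Matrix l m ℂ) (D : Matrix l' m' ℂ) (X : Matrix m n A) (Y : Matrix m' n' A) :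
    (C ⊗ₖ D).map (algebraMap ℂ A) * (X ⊗ₖ Y) =
      (C.map (algebraMap ℂ A) * X) ⊗ₖ (D.map (algebraMap ℂ A) * Y) := by
  ext ⟨i, i'⟩ ⟨j, j'⟩
  simp only [mul_apply, map_apply, kroneckerMap_apply, Fintype.sum_prod_type, Finset.sum_mul_sum]
  refine Finset.sum_congr rfl fun a _ => Finset.sum_congr rfl fun b _ => ?_
  rw [map_mul, mul_assoc, mul_assoc, ← mul_assoc _ (X a j), Algebra.commutes (D i' b), mul_assoc]

theorem StarSubalgebra.matrix_mul_mem (B : StarSubalgebra ℂ A) [Fintype m] {X : Matrix l m A}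
    {Y : Matrix m n A} (hX : ∀ i j, X i j ∈ B) (hY : ∀ i j, Y i j ∈ B) :
    ∀ i j, (X * Y) i j ∈ B := fun i j => by
  rw [mul_apply]
  exact sum_mem fun k _ => mul_mem (hX i k) (hY k j)

theorem StarSubalgebra.matrix_conjTranspose_mem (B : StarSubalgebra ℂ A) {X : Matrix l m A}
    (hX : ∀ i j, X i j ∈ B) : ∀ i j, Xᴴ i j ∈ B := fun i j => star_mem (hX j i)

theorem StarSubalgebra.trace_mem (B : StarSubalgebra ℂ A) [Fintype m] {X : Matrix m m A}
    (hX : ∀ i j, X i j ∈ B) : trace X ∈ B := sum_mem fun i _ => hX i i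

end ScalarMatrices

/-! ### Schur's lemma -/

namespace FinUnitaryRep

variable {G : Type*} [Group G] [TopologicalSpace G]

theorem conjTranspose_mat_mul_mat (σ : FinUnitaryRep G) (g : G) :
    (σ.mat g)ᴴ * σ.mat g = 1 := mem_unitaryGroup_iff'.1 (σ.mat_mem g)

theorem mat_mul_conjTranspose_mat (σ : FinUnitaryRep G) (g : G) :
    σ.mat g * (σ.mat g)ᴴ = 1 := mem_unitaryGroup_iff.1 (σ.mat_mem g)

theorem mat_inv (σ : FinUnitaryRep G) (g : G) : σ.mat g⁻¹ = (σ.mat g)ᴴ := by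
  have h : σ.mat g * σ.mat g⁻¹ = 1 := by rw [← mat_mul, mul_inv_cancel, σ.mat_one]
  calc σ.mat g⁻¹ = ((σ.mat g)ᴴ * σ.mat g) * σ.mat g⁻¹ := by
        rw [conjTranspose_mat_mul_mat, Matrix.one_mul]
    _ = (σ.mat g)ᴴ := by rw [Matrix.mul_assoc, h, Matrix.mul_one]

@[simp] theorem tensor_mat (σ τ : FinUnitaryRep G) (g : G) :
    (σ.tensor τ).mat g = σ.mat g ⊗ₖ τ.mat g := rfl

@[simp] theorem conjRep_mat (σ : FinUnitaryRep G) (g : G) :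
    σ.conjRep.mat g = (σ.mat g).map (starRingEnd ℂ) := rfl

/-- `T` is an intertwiner (a `G`-equivariant linear map) from `σ` to `τ`. -/
def IsIntertwiner (σ τ : FinUnitaryRep G) (T : Matrix τ.ι σ.ι ℂ) : Prop :=
  ∀ g, T * σ.mat g = τ.mat g * T

theorem IsIntertwiner.conjTranspose {σ τ : FinUnitaryRep G} {T : Matrix τ.ι σ.ι ℂ}
    (hT : IsIntertwiner σ τ T) : IsIntertwiner τ σ Tᴴ := fun g => by
  have h := congrArg Matrix.conjTranspose (hT g⁻¹)
  rw [conjTranspose_mul, conjTranspose_mul, mat_inv, mat_inv, conjTranspose_conjTranspose,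
    conjTranspose_conjTranspose] at h
  exact h.symm

theorem IsIntertwiner.mul {σ τ ρ : FinUnitaryRep G} {T : Matrix ρ.ι τ.ι ℂ} {R : Matrix τ.ι σ.ι ℂ}
    (hT : IsIntertwiner τ ρ T) (hR : IsIntertwiner σ τ R) : IsIntertwiner σ ρ (T * R) := fun g => by
  rw [Matrix.mul_assoc, hR g, ← Matrix.mul_assoc, hT g, Matrix.mul_assoc]

theorem IsIntertwiner.kronecker {σ σ' τ τ' : FinUnitaryRep G} {T : Matrix σ'.ι σ.ι ℂ}
    {R : Matrix τ'.ι τ.ι ℂ} (hT : IsIntertwiner σ σ' T) (hR : IsIntertwiner τ τ' R) :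
    IsIntertwiner (σ.tensor τ) (σ'.tensor τ') (T ⊗ₖ R) := fun g => by
  rw [tensor_mat, tensor_mat, ← mul_kronecker_mul, ← mul_kronecker_mul, hT g, hR g]

theorem isIntertwiner_one (σ : FinUnitaryRep G) : IsIntertwiner σ σ 1 := fun g => by
  rw [Matrix.one_mul, Matrix.mul_one]

/-- **Schur's lemma**: a self-intertwiner of an irreducible representation is a scalar, because
its eigenspaces are invariant subspaces. -/
theorem IsIrred.exists_eq_smul_one {σ : FinUnitaryRep G} (hσ : σ.IsIrred)
    {T : Matrix σ.ι σ.ι ℂ} (hT : IsIntertwiner σ σ T) : ∃ c : ℂ, T = c • (1 : Matrix σ.ι σ.ι ℂ) := by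
  obtain ⟨hne, hirr⟩ := hσ
  obtain ⟨c, hc⟩ := Module.End.exists_eigenvalue (Matrix.toLin' T)
  have key : ∀ w, w ∈ Module.End.eigenspace (Matrix.toLin' T) c ↔ T *ᵥ w = c • w := fun w => by
    rw [Module.End.mem_eigenspace_iff, toLin'_apply]
  refine ⟨c, ?_⟩
  rcases hirr (Module.End.eigenspace (Matrix.toLin' T) c) fun g w hw => by
    rw [key] at hw ⊢
    rw [mulVec_mulVec, hT g, ← mulVec_mulVec, hw, mulVec_smul] with h | h
  · exact absurd h hc
  · refine Matrix.toLin'.injective (LinearMap.ext fun w => ?_)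
    have := (key w).1 (h ▸ Submodule.mem_top)
    simpa using this

/-- **Schur's lemma**: a nonzero intertwiner between irreducible representations is a multiple of
a unitary one. -/
theorem IsIrred.equivalent {σ τ : FinUnitaryRep G} (hσ : σ.IsIrred) (hτ : τ.IsIrred)
    {T : Matrix τ.ι σ.ι ℂ} (hT : IsIntertwiner σ τ T) (h0 : T ≠ 0) : σ.Equivalent τ := by
  obtain ⟨c, hc⟩ := hσ.exists_eq_smul_one (hT.conjTranspose.mul hT)
  obtain ⟨d, hd⟩ := hτ.exists_eq_smul_one (hT.mul hT.conjTranspose)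
  have hdc : d = c := by
    have h : d • T = c • T := by
      calc d • T = (T * Tᴴ) * T := by rw [hd]; simp
        _ = c • T := by rw [Matrix.mul_assoc, hc]; simp
    by_contra hne
    have h2 : (d - c) • T = 0 := by rw [sub_smul, h, sub_self]
    exact h0 ((smul_eq_zero.1 h2).resolve_left (sub_ne_zero.2 hne))
  subst hdc
  -- a diagonal entry of `Tᴴ * T = d • 1` shows that `d` is a nonnegative real number
  obtain ⟨k⟩ := hσ.1
  obtain ⟨r, hr0, hr⟩ : ∃ r : ℝ, 0 ≤ r ∧ d = r := by
    refine ⟨∑ i, Complex.normSq (T i k), Finset.sum_nonneg fun i _ => Complex.normSq_nonneg _, ?_⟩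
    have h := congrFun (congrFun hc k) k
    simp only [mul_apply, conjTranspose_apply, Matrix.smul_apply, one_apply_eq, smul_eq_mul,
      mul_one] at h
    rw [← h, Complex.ofReal_sum]
    exact Finset.sum_congr rfl fun i _ => (Complex.normSq_eq_conj_mul_self).symm
  have hrne : r ≠ 0 := by
    rintro rfl
    rw [hr, Complex.ofReal_zero, zero_smul] at hc
    open scoped ComplexOrder in
    exact h0 (Matrix.conjTranspose_mul_self_eq_zero.1 hc)
  have hs : ((Real.sqrt r : ℝ) : ℂ)⁻¹ * ((Real.sqrt r : ℝ) : ℂ)⁻¹ * (r : ℂ) = 1 := by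
    rw [← mul_inv, ← Complex.ofReal_mul, Real.mul_self_sqrt hr0,
      inv_mul_cancel₀ (Complex.ofReal_ne_zero.2 hrne)]
  refine ⟨((Real.sqrt r : ℝ) : ℂ)⁻¹ • T, ?_, ?_, fun g => ?_⟩
  · rw [conjTranspose_smul, Matrix.smul_mul, Matrix.mul_smul, smul_smul, hc, hr, smul_smul]
    simp [hs]
  · rw [conjTranspose_smul, Matrix.smul_mul, Matrix.mul_smul, smul_smul, hd, hr, smul_smul]
    simp [hs]
  · rw [Matrix.smul_mul, hT g, Matrix.mul_smul]

/-- The direct sum `σ ⊕ τ` of two representations. -/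
abbrev directSum (σ τ : FinUnitaryRep G) : FinUnitaryRep G where
  ι := σ.ι ⊕ τ.ι
  hom :=
    { toFun := fun g => ⟨fromBlocks (σ.mat g) 0 0 (τ.mat g), by
        rw [mem_unitaryGroup_iff, star_eq_conjTranspose, fromBlocks_conjTranspose,
          fromBlocks_multiply]
        simp [mat_mul_conjTranspose_mat]⟩
      map_one' := by
        apply Subtype.ext
        simp [mat_one]
      map_mul' := fun g h => by
        apply Subtype.ext
        simp [mat_mul, fromBlocks_multiply] }
  continuous_hom := by
    refine Continuous.subtype_mk ?_ _
    exact σ.continuous_mat.matrix_fromBlocks continuous_const continuous_const τ.continuous_mat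

theorem directSum_mat (σ τ : FinUnitaryRep G) (g : G) :
    (σ.directSum τ).mat g = fromBlocks (σ.mat g) 0 0 (τ.mat g) := rfl

end FinUnitaryRep

theorem IrrepSystem.intertwiner_eq_zero {G : Type*} [Group G] [TopologicalSpace G]
    (I : IrrepSystem G) {i j : I.Idx} (hij : j ≠ i) {T : Matrix (I.rep i).ι (I.rep j).ι ℂ}
    (hT : FinUnitaryRep.IsIntertwiner (I.rep j) (I.rep i) T) : T = 0 := by
  by_contra h
  exact hij (I.inequivalent j i ((I.irred j).equivalent (I.irred i) hT h))

/-! ### Isotypic components of a decomposition -/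

theorem Matrix.blockDiagonal'_mul_apply {R o p : Type*} {m n : o → Type*} [NonUnitalNonAssocSemiring R]
    [Fintype o] [DecidableEq o] [∀ k, Fintype (n k)] (M : ∀ k, Matrix (m k) (n k) R)
    (X : Matrix (Σ k, n k) p R) (k : o) (i : m k) (j : p) :
    (blockDiagonal' M * X) ⟨k, i⟩ j = (M k * X.submatrix (fun v => (⟨k, v⟩ : Σ k, n k)) id) i j := by
  rw [mul_apply, Fintype.sum_sigma, Finset.sum_eq_single k]
  · simp [mul_apply, blockDiagonal'_apply]
  · intro k' _ hk
    refine Finset.sum_eq_zero fun v _ => ?_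
    rw [blockDiagonal'_apply_ne _ _ _ hk.symm, zero_mul]
  · simp

namespace Decomposition

variable {G : Type*} [Group G] [TopologicalSpace G] {I : IrrepSystem G} {σ : FinUnitaryRep G}

/-- The projection of `V_σ` onto the `k`-th irreducible summand of a decomposition. -/
def proj (D : Decomposition I σ) (k : Fin D.n) : Matrix (I.rep (D.idx k)).ι σ.ι ℂ :=
  D.U.submatrix (fun v => ⟨k, v⟩) id

theorem isIntertwiner_proj (D : Decomposition I σ) (k : Fin D.n) :
    FinUnitaryRep.IsIntertwiner σ (I.rep (D.idx k)) (D.proj k) := fun g => by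
  ext v i
  have h := congrFun (congrFun (D.intertwines g) ⟨k, v⟩) i
  rw [blockDiagonal'_mul_apply] at h
  exact h

end Decomposition

/-! ### The isometries of arbitrary representations -/

namespace CStarAction

variable {G : Type*} [Group G] [TopologicalSpace G] {A : Type*} [CStarAlgebra A]
  (α : CStarAction G A) {l m n : Type*}

theorem map_mul [Fintype m] (g : G) (X : Matrix l m A) (Y : Matrix m n A) :
    (X * Y).map (α.toHom g) = X.map (α.toHom g) * Y.map (α.toHom g) := by
  ext i j
  simp [mul_apply]

theorem map_conjTranspose (g : G) (X : Matrix m n A) :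
    Xᴴ.map (α.toHom g) = (X.map (α.toHom g))ᴴ := by
  ext i j
  simp [map_star]

theorem map_algebraMap (g : G) (C : Matrix m n ℂ) :
    (C.map (algebraMap ℂ A)).map (α.toHom g) = C.map (algebraMap ℂ A) := by
  ext i j
  simp only [map_apply]
  exact AlgHomClass.commutes (α.toHom g) _

theorem map_diagonal [DecidableEq m] (g : G) {b : A} (hb : b ∈ α.fixed) :
    (diagonal fun _ => b : Matrix m m A).map (α.toHom g) = diagonal fun _ => b := by
  ext i j
  by_cases h : i = j
  · subst h
    simpa using hb g
  · simp [h]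

theorem mem_fixed_of_map_eq {X : Matrix m n A} (h : ∀ g, X.map (α.toHom g) = X) (i : m) (j : n) :
    X i j ∈ α.fixed := fun g => congrFun (congrFun (h g) i) j

theorem map_eq_of_mem_fixed {X : Matrix m n A} (h : ∀ i j, X i j ∈ α.fixed) (g : G) :
    X.map (α.toHom g) = X := by
  ext i j
  exact h i j g

end CStarAction

namespace IsometrySystem

variable {G : Type*} [Group G] [TopologicalSpace G] {A : Type*} [CStarAlgebra A]
  {α : CStarAction G A} {I : IrrepSystem G}

theorem ext_row (S : IsometrySystem α I) {σ : FinUnitaryRep G} (D : Decomposition I σ)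
    (k : Fin D.n) : (S.ext D).submatrix (fun v => ⟨k, v⟩) id =
      S.s (D.idx k) * (D.proj k).map (algebraMap ℂ A) := by
  ext κ i
  exact blockDiagonal'_mul_apply _ _ _ _ _

theorem ext_isometry (S : IsometrySystem α I) {σ : FinUnitaryRep G} (D : Decomposition I σ) :
    (S.ext D)ᴴ * S.ext D = 1 := by
  have h : (blockDiagonal' fun k => S.s (D.idx k))ᴴ * blockDiagonal' (fun k => S.s (D.idx k)) =
      1 := by
    rw [blockDiagonal'_conjTranspose,
      ← blockDiagonal'_mul (fun k => (S.s (D.idx k))ᴴ) (fun k => S.s (D.idx k))]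
    simp_rw [S.isometry]
    exact blockDiagonal'_one
  rw [ext, conjTranspose_mul, Matrix.mul_assoc, ← Matrix.mul_assoc _ (blockDiagonal' _), h,
    Matrix.one_mul, conjTranspose_map_algebraMap, ← map_algebraMap_mul, D.star_mul_self,
    map_algebraMap_one]

theorem ext_equivariant (S : IsometrySystem α I) {σ : FinUnitaryRep G} (D : Decomposition I σ)
    (g : G) : (S.ext D).map (α.toHom g) = S.ext D * (σ.mat g).map (algebraMap ℂ A) := by
  have h : (blockDiagonal' fun k => S.s (D.idx k)).map (α.toHom g) =
      blockDiagonal' (fun k => S.s (D.idx k)) *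
        (blockDiagonal' fun k => (I.rep (D.idx k)).mat g).map (algebraMap ℂ A) := by
    rw [blockDiagonal'_map _ _ (map_zero _), blockDiagonal'_map _ _ (map_zero _),
      ← blockDiagonal'_mul]
    simp_rw [S.equivariant]
  rw [ext, α.map_mul, α.map_algebraMap, h, Matrix.mul_assoc, ← map_algebraMap_mul,
    ← D.intertwines, map_algebraMap_mul, Matrix.mul_assoc]

/-- The adjoint isometry transforms by `α_g(s(σ)*) = σ_g* s(σ)*`. -/
theorem ext_conjTranspose_equivariant (S : IsometrySystem α I) {σ : FinUnitaryRep G}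
    (D : Decomposition I σ) (g : G) :
    (S.ext D)ᴴ.map (α.toHom g) = (σ.mat g)ᴴ.map (algebraMap ℂ A) * (S.ext D)ᴴ := by
  rw [α.map_conjTranspose, ext_equivariant, conjTranspose_mul, conjTranspose_map_algebraMap]

/-! ### Star-subalgebras compatible with the factor system -/

variable (S : IsometrySystem α I) (dec : ∀ σ : FinUnitaryRep G, Decomposition I σ)

/-- A star-subalgebra `B` of `A` that contains the coefficients of the factor system `(γ, ω)` of
the irreducible representations, in the sense that `γ_σ` maps `B` to matrices over `B` and
`ω(σ, τ)` is a matrix over `B`. -/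
structure IsCompatible (B : StarSubalgebra ℂ A) : Prop where
  coact_mem : ∀ i, ∀ b ∈ B, ∀ k l, coact (S.s i) b k l ∈ B
  ωIrr_mem : ∀ i j, ∀ m p, S.ωIrr dec i j m p ∈ B

theorem coact_mem_fixed {σ : FinUnitaryRep G} {κ : Type} {s : Matrix κ σ.ι A}
    (hs : ∀ g, s.map (α.toHom g) = s * (σ.mat g).map (algebraMap ℂ A)) {b : A} (hb : b ∈ α.fixed)
    (k l : κ) : coact s b k l ∈ α.fixed := by
  refine α.mem_fixed_of_map_eq (fun g => ?_) k l
  rw [coact, α.map_mul, α.map_mul, α.map_conjTranspose, hs, α.map_diagonal g hb, conjTranspose_mul,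
    conjTranspose_map_algebraMap, Matrix.mul_assoc s, map_algebraMap_mul_diagonal,
    ← Matrix.mul_assoc, Matrix.mul_assoc s, Matrix.mul_assoc (diagonal _), ← map_algebraMap_mul,
    σ.mat_mul_conjTranspose_mat, map_algebraMap_one, Matrix.mul_one]

theorem cocyc_mem_fixed {σ τ : FinUnitaryRep G} {κ₁ κ₂ κ₃ : Type} {s₁ : Matrix κ₁ σ.ι A}
    {s₂ : Matrix κ₂ τ.ι A} {s₁₂ : Matrix κ₃ (σ.ι × τ.ι) A}
    (hs₁ : ∀ g, s₁.map (α.toHom g) = s₁ * (σ.mat g).map (algebraMap ℂ A))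
    (hs₂ : ∀ g, s₂.map (α.toHom g) = s₂ * (τ.mat g).map (algebraMap ℂ A))
    (hs₁₂ : ∀ g, s₁₂.map (α.toHom g) = s₁₂ * ((σ.tensor τ).mat g).map (algebraMap ℂ A))
    (k : κ₃) (l : κ₁ × κ₂) : cocyc s₁₂ s₁ s₂ k l ∈ α.fixed := by
  refine α.mem_fixed_of_map_eq (fun g => ?_) k l
  have h : (s₁ᴴ ⊗ₖ s₂ᴴ).map (α.toHom g) =
      ((σ.mat g)ᴴ ⊗ₖ (τ.mat g)ᴴ).map (algebraMap ℂ A) * (s₁ᴴ ⊗ₖ s₂ᴴ) := by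
    rw [kronecker_map_algebraMap_mul, ← conjTranspose_map_algebraMap,
      ← conjTranspose_map_algebraMap, ← conjTranspose_mul, ← conjTranspose_mul, ← hs₁, ← hs₂]
    ext i j
    simp [map_star]
  rw [cocyc, α.map_mul, hs₁₂, h, Matrix.mul_assoc, ← Matrix.mul_assoc _ _ (_ ⊗ₖ _),
    ← map_algebraMap_mul, FinUnitaryRep.tensor_mat, ← mul_kronecker_mul,
    σ.mat_mul_conjTranspose_mat, τ.mat_mul_conjTranspose_mat, one_kronecker_one,
    map_algebraMap_one, Matrix.one_mul]

theorem isCompatible_fixed : S.IsCompatible dec α.fixed where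
  coact_mem i _ hb := coact_mem_fixed (S.equivariant i) hb
  ωIrr_mem i j := cocyc_mem_fixed (S.equivariant i) (S.equivariant j) (S.ext_equivariant _)

variable {S dec} {B : StarSubalgebra ℂ A}

theorem IsCompatible.s_mul_mem (hB : S.IsCompatible dec B) {i j : I.Idx}
    {T : Matrix (I.rep i).ι (I.rep j).ι ℂ}
    (hT : FinUnitaryRep.IsIntertwiner (I.rep j) (I.rep i) T) {b : A} (hb : b ∈ B)
    (k : S.κ i) (l : S.κ j) :
    (S.s i * T.map (algebraMap ℂ A) * (diagonal fun _ => b : Matrix (I.rep j).ι (I.rep j).ι A) *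
      (S.s j)ᴴ) k l ∈ B := by
  by_cases hij : j = i
  · subst hij
    obtain ⟨c, rfl⟩ := (I.irred j).exists_eq_smul_one hT
    have h : S.s j * (c • (1 : Matrix (I.rep j).ι (I.rep j).ι ℂ)).map (algebraMap ℂ A) *
        (diagonal fun _ => b : Matrix (I.rep j).ι (I.rep j).ι A) * (S.s j)ᴴ =
          c • coact (S.s j) b := by
      have h1 : (c • (1 : Matrix (I.rep j).ι (I.rep j).ι ℂ)).map (algebraMap ℂ A) =
          c • (1 : Matrix (I.rep j).ι (I.rep j).ι A) := by
        ext a b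
        by_cases hab : a = b <;> simp [hab, Algebra.algebraMap_eq_smul_one]
      rw [h1, Matrix.mul_smul, Matrix.mul_one, Matrix.smul_mul, Matrix.smul_mul, coact]
    rw [h]
    exact B.smul_mem (hB.coact_mem j b hb k l) c
  · rw [I.intertwiner_eq_zero hij hT]
    simp

/-- By Schur's lemma, compatibility extends from `γ_σ(b) = s(σ) b s(σ)*` with `σ` irreducible
to `s(ρ) (b ⊗ T) s(ρ')*` for every intertwiner `T` between arbitrary representations. -/
theorem IsCompatible.ext_mul_mem (hB : S.IsCompatible dec B) {ρ ρ' : FinUnitaryRep G}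
    (D : Decomposition I ρ) (D' : Decomposition I ρ') {T : Matrix ρ.ι ρ'.ι ℂ}
    (hT : FinUnitaryRep.IsIntertwiner ρ' ρ T) {b : A} (hb : b ∈ B) (k : S.Hι D) (l : S.Hι D') :
    (S.ext D * T.map (algebraMap ℂ A) * (diagonal fun _ => b : Matrix ρ'.ι ρ'.ι A) *
      (S.ext D')ᴴ) k l ∈ B := by
  obtain ⟨m, κ⟩ := k
  obtain ⟨m', κ'⟩ := l
  have h : (S.ext D * T.map (algebraMap ℂ A) * (diagonal fun _ => b : Matrix ρ'.ι ρ'.ι A) *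
      (S.ext D')ᴴ) ⟨m, κ⟩ ⟨m', κ'⟩ =
      ((S.ext D).submatrix (fun v => ⟨m, v⟩) id * T.map (algebraMap ℂ A) *
        (diagonal fun _ => b : Matrix ρ'.ι ρ'.ι A) *
          ((S.ext D').submatrix (fun v => ⟨m', v⟩) id)ᴴ) κ κ' := rfl
  have h2 : (S.ext D).submatrix (fun v => ⟨m, v⟩) id * T.map (algebraMap ℂ A) *
        (diagonal fun _ => b : Matrix ρ'.ι ρ'.ι A) * ((S.ext D').submatrix (fun v => ⟨m', v⟩) id)ᴴ =
      S.s (D.idx m) * (D.proj m * T * (D'.proj m')ᴴ).map (algebraMap ℂ A) *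
        (diagonal fun _ => b : Matrix (I.rep (D'.idx m')).ι (I.rep (D'.idx m')).ι A) *
          (S.s (D'.idx m'))ᴴ := by
    rw [ext_row, ext_row, conjTranspose_mul, conjTranspose_map_algebraMap, map_algebraMap_mul,
      map_algebraMap_mul]
    simp only [Matrix.mul_assoc]
    rw [← Matrix.mul_assoc (diagonal _) (Matrix.map _ _), ← map_algebraMap_mul_diagonal,
      Matrix.mul_assoc]
  rw [h, h2]
  exact hB.s_mul_mem (((D.isIntertwiner_proj m).mul hT).mul
    (D'.isIntertwiner_proj m').conjTranspose) hb κ κ'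

theorem IsCompatible.ext_mul_ext_mem (hB : S.IsCompatible dec B) {ρ ρ' : FinUnitaryRep G}
    (D : Decomposition I ρ) (D' : Decomposition I ρ') {T : Matrix ρ.ι ρ'.ι ℂ}
    (hT : FinUnitaryRep.IsIntertwiner ρ' ρ T) (k : S.Hι D) (l : S.Hι D') :
    (S.ext D * T.map (algebraMap ℂ A) * (S.ext D')ᴴ) k l ∈ B := by
  simpa using hB.ext_mul_mem D D' hT (one_mem B) k l

theorem IsCompatible.γ_mem (hB : S.IsCompatible dec B) (σ : FinUnitaryRep G) {b : A} (hb : b ∈ B)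
    (k l : S.Hι (dec σ)) : S.γ dec σ b k l ∈ B := by
  simpa [γ, coact, map_algebraMap_one] using
    hB.ext_mul_mem (dec σ) (dec σ) σ.isIntertwiner_one hb k l

theorem IsCompatible.ω_mem (hB : S.IsCompatible dec B) (σ τ : FinUnitaryRep G)
    (m : S.Hι (dec (σ.tensor τ))) (p : S.Hι (dec σ) × S.Hι (dec τ)) : S.ω dec σ τ m p ∈ B := by
  obtain ⟨⟨k, κ⟩, ⟨l, κ'⟩⟩ := p
  let i := (dec σ).idx k
  let j := (dec τ).idx l
  let P := (dec σ).proj k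
  let Q := (dec τ).proj l
  let ρ := (I.rep i).tensor (I.rep j)
  -- the column block of the pair of summands `(k, l)`, with `s(ρ)* s(ρ) = 1` inserted
  have h : S.ω dec σ τ m (⟨k, κ⟩, ⟨l, κ'⟩) =
      ((S.ext (dec (σ.tensor τ)) * (Pᴴ ⊗ₖ Qᴴ).map (algebraMap ℂ A) * (S.ext (dec ρ))ᴴ) *
        S.ωIrr dec i j) m (κ, κ') := by
    have h1 : S.ω dec σ τ m (⟨k, κ⟩, ⟨l, κ'⟩) = (S.ext (dec (σ.tensor τ)) *
        (((S.ext (dec σ)).submatrix (fun v => ⟨k, v⟩) id)ᴴ ⊗ₖ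
          ((S.ext (dec τ)).submatrix (fun v => ⟨l, v⟩) id)ᴴ)) m (κ, κ') := rfl
    rw [h1, ext_row, ext_row, conjTranspose_mul, conjTranspose_mul, conjTranspose_map_algebraMap,
      conjTranspose_map_algebraMap, ← kronecker_map_algebraMap_mul, ωIrr, cocyc, Matrix.mul_assoc,
      ← Matrix.mul_assoc (S.ext (dec ρ))ᴴ, ext_isometry, Matrix.one_mul, Matrix.mul_assoc]
  rw [h]
  refine B.matrix_mul_mem (fun a b => hB.ext_mul_ext_mem _ _ ?_ a b) (hB.ωIrr_mem i j) _ _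
  exact ((dec σ).isIntertwiner_proj k).conjTranspose.kronecker
    ((dec τ).isIntertwiner_proj l).conjTranspose

theorem IsCompatible.mulArg_mem (hB : S.IsCompatible dec B) (σ τ : FinUnitaryRep G) {b c : A}
    (hb : b ∈ B) (hc : c ∈ B) (η : S.Hι (dec σ) → ℂ) (ϑ : S.Hι (dec τ) → ℂ)
    (m : S.Hι (dec (σ.tensor τ))) : S.mulArg dec σ τ b c η ϑ m ∈ B := by
  refine sum_mem fun p _ => mul_mem (hB.ω_mem σ τ m p) (sum_mem fun q _ => mul_mem ?_ ?_)
  · refine mul_mem (b := S.γ dec τ b p.2 q.2) ?_ (hB.γ_mem τ hb _ _)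
    rw [one_apply]
    split_ifs
    · exact one_mem B
    · exact zero_mem B
  · exact B.smul_mem hc _

theorem IsCompatible.J_mem (hB : S.IsCompatible dec B) (σ : FinUnitaryRep G)
    {x : S.Hι (dec σ) → A} (hx : ∀ k, x k ∈ B) (l : S.Hι (dec σ.conjRep)) :
    S.J dec σ x l ∈ B := by
  have h : S.J dec σ x l = ∑ k, (S.γ dec σ.conjRep (star (x k)) *ᵥ
    fun l => ((S.ω dec σ σ.conjRep)ᴴ *ᵥ simpleVec 1 (S.invVec dec σ)) (k, l)) l :=
      Finset.sum_apply _ _ _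
  rw [h]
  refine sum_mem fun k _ => sum_mem fun l' _ => mul_mem (hB.γ_mem _ (star_mem (hx k)) _ _)
    (sum_mem fun m _ => mul_mem (star_mem (hB.ω_mem σ σ.conjRep _ _)) ?_)
  exact B.smul_mem (one_mem B) _

end IsometrySystem

/-! ### Invariant vectors -/

theorem IrrepSystem.eq_zero_of_invariant {G : Type*} [Group G] [TopologicalSpace G]
    (I : IrrepSystem G) {i : I.Idx} (hi : i ≠ I.one) {u : (I.rep i).ι → ℂ}
    (hu : ∀ g, (I.rep i).mat g *ᵥ u = u) : u = 0 := by
  -- `u` is the column of an intertwiner from the trivial representation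
  have hT : FinUnitaryRep.IsIntertwiner (I.rep I.one) (I.rep i)
      (Matrix.of fun v (_ : (I.rep I.one).ι) => u v) := fun g => by
    rw [I.mat_one, Matrix.mul_one]
    ext v w
    exact (congrFun (hu g) v).symm
  have h0 := I.intertwiner_eq_zero hi.symm hT
  obtain ⟨w⟩ := (I.irred I.one).1
  ext v
  exact congrFun (congrFun h0 v) w

namespace IsometrySystem

variable {G : Type*} [Group G] [TopologicalSpace G] {A : Type*} [CStarAlgebra A]
  {α : CStarAction G A} {I : IrrepSystem G}

open scoped Classical in
/-- The image in `H_σ` of an invariant vector `u` of `V_σ`: its coordinates in the trivial summands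
of `V_σ` are carried over to the corresponding copies of `H_1 = ℂ`. -/
noncomputable def invImage (S : IsometrySystem α I) {σ : FinUnitaryRep G} (D : Decomposition I σ)
    (u : σ.ι → ℂ) : S.Hι D → ℂ :=
  fun m => if D.idx m.1 = I.one then ∑ v, (D.U *ᵥ u) ⟨m.1, v⟩ else 0

/-- `s(σ)` maps an invariant vector `u` of `V_σ` to `1 ⊗ u'`, where `u'` is the image of `u` in
`H_σ`, since `s(1) = 1` and `u` has no components in nontrivial irreducible summands. -/
theorem ext_mulVec_of_invariant (S : IsometrySystem α I) {σ : FinUnitaryRep G}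
    (D : Decomposition I σ) {u : σ.ι → ℂ} (hu : ∀ g, σ.mat g *ᵥ u = u) :
    (S.ext D *ᵥ fun i => algebraMap ℂ A (u i)) = fun m => algebraMap ℂ A (S.invImage D u m) := by
  ext ⟨m, κ⟩
  have hinv : ∀ g, (I.rep (D.idx m)).mat g *ᵥ (D.proj m *ᵥ u) = D.proj m *ᵥ u := fun g => by
    rw [mulVec_mulVec, ← D.isIntertwiner_proj m g, ← mulVec_mulVec, hu]
  have h1 : (S.ext D *ᵥ fun i => algebraMap ℂ A (u i)) ⟨m, κ⟩ =
      ((S.ext D).submatrix (fun v => ⟨m, v⟩) id *ᵥ fun i => algebraMap ℂ A (u i)) κ := rfl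
  have h2 : ((D.proj m).map (algebraMap ℂ A) *ᵥ fun i => algebraMap ℂ A (u i)) =
      fun v => algebraMap ℂ A ((D.proj m *ᵥ u) v) := by
    ext v
    simp [mulVec, dotProduct]
  rw [h1, ext_row, ← mulVec_mulVec, h2, invImage]
  by_cases hm : D.idx m = I.one
  · have hs : ∀ (i : I.Idx) (_ : i = I.one) (κ : S.κ i) (w : (I.rep i).ι → ℂ),
        (S.s i *ᵥ fun v => algebraMap ℂ A (w v)) κ = algebraMap ℂ A (∑ v, w v) := by
      rintro _ rfl κ w
      simp [mulVec, dotProduct, S.s_one]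
    rw [if_pos hm, hs _ hm]
    rfl
  · rw [if_neg hm, I.eq_zero_of_invariant hm hinv]
    simp [mulVec, dotProduct]

theorem ext_mulVec_of_invariant_mem (S : IsometrySystem α I) (B : StarSubalgebra ℂ A)
    {σ : FinUnitaryRep G} (D : Decomposition I σ) {u : σ.ι → ℂ} (hu : ∀ g, σ.mat g *ᵥ u = u)
    (m : S.Hι D) : (S.ext D *ᵥ fun i => algebraMap ℂ A (u i)) m ∈ B := by
  rw [S.ext_mulVec_of_invariant D hu]
  exact algebraMap_mem B _

/-! ### The elements `a_σ(x)` -/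

variable (S : IsometrySystem α I) (dec : ∀ σ : FinUnitaryRep G, Decomposition I σ)

theorem a_tens (σ : FinUnitaryRep G) (y : S.Hι (dec σ) → A) (w : σ.ι → ℂ) :
    S.a dec σ (tens y w) = ∑ i, w i • ((S.ext (dec σ))ᴴ *ᵥ y) i := by
  simp only [a, trace, diag, mul_apply, tens, mulVec, dotProduct, Finset.smul_sum, mul_smul_comm]

theorem act_a (g : G) (σ : FinUnitaryRep G) {x : Matrix (S.Hι (dec σ)) σ.ι A}
    (hx : ∀ k i, x k i ∈ α.fixed) :
    α.toHom g (S.a dec σ x) = S.a dec σ (x * (σ.mat g)ᴴ.map (algebraMap ℂ A)) := by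
  have h : α.toHom g (S.a dec σ x) = trace (((S.ext (dec σ))ᴴ * x).map (α.toHom g)) :=
    map_sum _ _ _
  rw [h, α.map_mul, ext_conjTranspose_equivariant, α.map_eq_of_mem_fixed hx, Matrix.mul_assoc,
    ← trace_mul_map_algebraMap, a, Matrix.mul_assoc]

theorem tens_mul_conjTranspose {κ : Type} (σ : FinUnitaryRep G) (g : G) (y : κ → A)
    (w : σ.ι → ℂ) : tens y w * (σ.mat g)ᴴ.map (algebraMap ℂ A) =
      tens y (σ.conjRep.mat g *ᵥ w) := by
  ext k i
  simp only [mul_apply, tens, mulVec, dotProduct, map_apply, conjTranspose_apply,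
    FinUnitaryRep.conjRep_mat, Finset.sum_smul]
  refine Finset.sum_congr rfl fun j _ => ?_
  rw [← Algebra.commutes, ← Algebra.smul_def, smul_smul, starRingEnd_apply]

theorem conjTranspose_mul_coact {κ ι : Type} [Fintype κ] [Fintype ι] [DecidableEq ι]
    {s : Matrix κ ι A} (hs : sᴴ * s = 1) (b : A) :
    sᴴ * coact s b = (diagonal fun _ => b : Matrix ι ι A) * sᴴ := by
  rw [coact, ← Matrix.mul_assoc, ← Matrix.mul_assoc, hs, Matrix.one_mul]

theorem ext_conjTranspose_mulVec_mulArg (σ τ : FinUnitaryRep G) (b c : A)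
    (η : S.Hι (dec σ) → ℂ) (ϑ : S.Hι (dec τ) → ℂ) (i : σ.ι) (j : τ.ι) :
    ((S.ext (dec (σ.tensor τ)))ᴴ *ᵥ S.mulArg dec σ τ b c η ϑ) (i, j) =
      ((S.ext (dec σ))ᴴ *ᵥ simpleVec b η) i * ((S.ext (dec τ))ᴴ *ᵥ simpleVec c ϑ) j := by
  have hω : (S.ext (dec (σ.tensor τ)))ᴴ * S.ω dec σ τ =
      (S.ext (dec σ))ᴴ ⊗ₖ (S.ext (dec τ))ᴴ := by
    rw [ω, cocyc, ← Matrix.mul_assoc, ext_isometry, Matrix.one_mul]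
  have hγ : ∀ k l, (((S.ext (dec σ))ᴴ ⊗ₖ (S.ext (dec τ))ᴴ) *
      ((1 : Matrix (S.Hι (dec σ)) (S.Hι (dec σ)) A) ⊗ₖ S.γ dec τ b)) (i, j) (k, l) =
        (S.ext (dec σ))ᴴ i k * (b * (S.ext (dec τ))ᴴ j l) := fun k l => by
    have h := congrFun (congrFun (conjTranspose_mul_coact (S.ext_isometry (dec τ)) b) j) l
    rw [diagonal_mul] at h
    rw [← h, mul_apply, mul_apply, Fintype.sum_prod_type, Finset.sum_eq_single k]
    · rw [Finset.mul_sum]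
      refine Finset.sum_congr rfl fun l' _ => ?_
      simp [γ, mul_assoc]
    · intro k' _ hk
      simp [one_apply_ne hk]
    · simp
  rw [mulArg, mulVec_mulVec, mulVec_mulVec, hω]
  simp only [mulVec, dotProduct, Fintype.sum_prod_type, hγ, simpleVec, Finset.sum_mul_sum]
  refine Finset.sum_congr rfl fun k _ => Finset.sum_congr rfl fun l _ => ?_
  simp only [mul_smul_comm, smul_mul_assoc, smul_smul, mul_assoc, mul_comm (η k)]

theorem a_mul_a (σ τ : FinUnitaryRep G) (b c : A) (η : S.Hι (dec σ) → ℂ) (ϑ : S.Hι (dec τ) → ℂ)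
    (v : σ.ι → ℂ) (w : τ.ι → ℂ) :
    S.a dec σ (tens (simpleVec b η) v) * S.a dec τ (tens (simpleVec c ϑ) w) =
      S.a dec (σ.tensor τ) (tens (S.mulArg dec σ τ b c η ϑ) fun p => v p.1 * w p.2) := by
  have h : S.a dec (σ.tensor τ) (tens (S.mulArg dec σ τ b c η ϑ) fun p => v p.1 * w p.2) =
      ∑ p : σ.ι × τ.ι, (v p.1 * w p.2) • (((S.ext (dec σ))ᴴ *ᵥ simpleVec b η) p.1 *
        ((S.ext (dec τ))ᴴ *ᵥ simpleVec c ϑ) p.2) := by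
    refine (S.a_tens dec (σ.tensor τ) _ _).trans (Finset.sum_congr rfl fun p _ => ?_)
    rw [← ext_conjTranspose_mulVec_mulArg]
  rw [h, a_tens, a_tens, Fintype.sum_prod_type, Finset.sum_mul_sum]
  simp only [smul_mul_smul_comm]

/-- The vector `∑ e_i ⊗ ē_i` of `V_σ ⊗ V̄_σ` is invariant: its coordinate matrix is the identity. -/
theorem tensor_conjRep_mulVec_diag (σ : FinUnitaryRep G) (g : G) :
    (σ.tensor σ.conjRep).mat g *ᵥ (fun p : σ.ι × σ.ι => if p.1 = p.2 then (1 : ℂ) else 0) =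
      fun p => if p.1 = p.2 then 1 else 0 := by
  ext ⟨i, j⟩
  have h := congrFun (congrFun (σ.mat_mul_conjTranspose_mat g) i) j
  simp only [mul_apply, conjTranspose_apply, one_apply] at h
  simp [mulVec, dotProduct, Fintype.sum_prod_type, ← h]

/-- The vector `(⟨η| ⊗ 1) ω(σ, σ̄)* (1 ⊗ r)` for the basis vector `η = e_k` of `H_σ`. -/
theorem ω_conjTranspose_mulVec_invVec (σ : FinUnitaryRep G) (k : S.Hι (dec σ)) :
    (fun l => ((S.ω dec σ σ.conjRep)ᴴ *ᵥ simpleVec 1 (S.invVec dec σ)) (k, l)) =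
      S.ext (dec σ.conjRep) *ᵥ fun i => S.ext (dec σ) k i := by
  have hr : (simpleVec 1 (S.invVec dec σ) : _ → A) = S.ext (dec (σ.tensor σ.conjRep)) *ᵥ
      fun p => algebraMap ℂ A (if p.1 = p.2 then 1 else 0) := by
    rw [S.ext_mulVec_of_invariant _ (tensor_conjRep_mulVec_diag σ)]
    ext m
    rw [simpleVec, ← Algebra.algebraMap_eq_smul_one]
    rfl
  ext l
  rw [hr, mulVec_mulVec, ω, cocyc, conjTranspose_mul, Matrix.mul_assoc, ext_isometry,
    Matrix.mul_one]
  simp only [mulVec, dotProduct, Fintype.sum_prod_type, conjTranspose_apply, kroneckerMap_apply,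
    star_mul, star_star]
  refine Finset.sum_congr rfl fun i _ => ?_
  rw [Finset.sum_eq_single i]
  · simp
  · intro j _ hj
    simp [hj.symm]
  · simp

theorem star_a (σ : FinUnitaryRep G) (x : S.Hι (dec σ) → A) (v : σ.ι → ℂ) :
    star (S.a dec σ (tens x (star v))) = S.a dec σ.conjRep (tens (S.J dec σ x) v) := by
  have hJ : S.J dec σ x = ∑ k, S.γ dec σ.conjRep (star (x k)) *ᵥ
      (S.ext (dec σ.conjRep) *ᵥ fun i => S.ext (dec σ) k i) :=
    Finset.sum_congr rfl fun k _ => by rw [ω_conjTranspose_mulVec_invVec]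
  have h : ∀ i, ((S.ext (dec σ.conjRep))ᴴ *ᵥ S.J dec σ x) i =
      star (((S.ext (dec σ))ᴴ *ᵥ x) i) := fun i => by
    rw [hJ, mulVec_sum, Finset.sum_apply]
    simp only [mulVec, dotProduct, star_sum, star_mul, conjTranspose_apply, star_star]
    refine Finset.sum_congr rfl fun k _ => ?_
    have h2 : (S.ext (dec σ.conjRep))ᴴ *ᵥ (S.γ dec σ.conjRep (star (x k)) *ᵥ
        (S.ext (dec σ.conjRep) *ᵥ fun i => S.ext (dec σ) k i)) =
          (diagonal fun _ => star (x k) : Matrix σ.ι σ.ι A) *ᵥ fun i => S.ext (dec σ) k i := by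
      rw [mulVec_mulVec, γ, conjTranspose_mul_coact (S.ext_isometry _), mulVec_mulVec,
        Matrix.mul_assoc, ext_isometry, Matrix.mul_one]
    exact (congrFun h2 i).trans (mulVec_diagonal _ _ i)
  rw [a_tens, a_tens, star_sum]
  refine Finset.sum_congr rfl fun i _ => ?_
  rw [h, star_smul, Pi.star_apply, star_star]

end IsometrySystem

/-! ### Convolution operators on a compact group -/

section PeterWeyl

open MeasureTheory

variable {G : Type*} [Group G] [TopologicalSpace G] [IsTopologicalGroup G]

/-- The left translate `x ↦ f (g⁻¹ x)` of a continuous function. -/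
noncomputable def leftTranslate (g : G) (f : C(G, ℂ)) : C(G, ℂ) := ⟨fun x => f (g⁻¹ * x), by fun_prop⟩

@[simp] theorem leftTranslate_apply (g x : G) (f : C(G, ℂ)) :
    leftTranslate g f x = f (g⁻¹ * x) := rfl

theorem leftTranslate_mul (g h : G) (f : C(G, ℂ)) :
    leftTranslate (g * h) f = leftTranslate g (leftTranslate h f) := by
  ext x
  simp [mul_assoc]

theorem leftTranslate_one (f : C(G, ℂ)) : leftTranslate 1 f = f := by
  ext x
  simp

theorem leftTranslate_smul (g : G) (c : ℂ) (f : C(G, ℂ)) :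
    leftTranslate g (c • f) = c • leftTranslate g f := by
  ext x
  simp

theorem leftTranslate_sum_smul {ι : Type*} [Fintype ι] (g : G) (c : ι → ℂ) (u : ι → C(G, ℂ)) :
    leftTranslate g (∑ i, c i • u i) = ∑ i, c i • leftTranslate g (u i) := by
  ext x
  simp

theorem continuous_leftTranslate (f : C(G, ℂ)) : Continuous fun g => leftTranslate g f :=
  (ContinuousMap.curry ⟨fun p : G × G => f (p.1⁻¹ * p.2), by fun_prop⟩).continuous

variable [CompactSpace G] [MeasurableSpace G] [BorelSpace G] (μ : Measure G) [μ.IsHaarMeasure]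

local notation "⟪" f "," h "⟫" => inner ℂ f h

/-- The class of a continuous function in `L²(G)`. -/
local notation "toL2" => ContinuousMap.toLp (E := ℂ) 2 μ ℂ

theorem inner_leftTranslate (g : G) (f h : C(G, ℂ)) :
    ⟪toL2 (leftTranslate g f), toL2 (leftTranslate g h)⟫ = ⟪toL2 f, toL2 h⟫ := by
  rw [ContinuousMap.inner_toLp, ContinuousMap.inner_toLp]
  exact integral_mul_left_eq_self (fun x => h x * conj (f x)) g⁻¹

/-- The convolution operator `L²(G) → C(G)` with `(K f)(x) = ∫ conj (φ (x⁻¹ y)) f(y) dy`. -/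
noncomputable def convOp (φ : C(G, ℂ)) : Lp ℂ 2 μ →L[ℂ] C(G, ℂ) :=
  LinearMap.mkContinuous
    { toFun := fun f => ⟨fun x => ⟪toL2 (leftTranslate x φ), f⟫,
        ((toL2).continuous.comp (continuous_leftTranslate φ)).inner continuous_const⟩
      map_add' := fun f h => by
        ext x
        exact inner_add_right (𝕜 := ℂ) (toL2 (leftTranslate x φ)) f h
      map_smul' := fun c f => by
        ext x
        exact inner_smul_right (𝕜 := ℂ) (toL2 (leftTranslate x φ)) f c }
    (‖toL2 φ‖) fun f => by
      rw [ContinuousMap.norm_le _ (by positivity)]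
      intro x
      refine (norm_inner_le_norm (𝕜 := ℂ) (toL2 (leftTranslate x φ)) f).trans (le_of_eq ?_)
      congr 1
      rw [@norm_eq_sqrt_re_inner ℂ, @norm_eq_sqrt_re_inner ℂ, inner_leftTranslate]

theorem convOp_apply (φ : C(G, ℂ)) (f : Lp ℂ 2 μ) (x : G) :
    convOp μ φ f x = ⟪toL2 (leftTranslate x φ), f⟫ := rfl

/-- Convolution operators commute with left translations. -/
theorem convOp_leftTranslate (φ f : C(G, ℂ)) (g : G) :
    convOp μ φ (toL2 (leftTranslate g f)) = leftTranslate g (convOp μ φ (toL2 f)) := by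
  ext x
  rw [leftTranslate_apply, convOp_apply, convOp_apply, ← inner_leftTranslate μ g _ f,
    ← leftTranslate_mul, mul_inv_cancel_left]

/-- The unit ball of `L²(G)` is mapped to an equicontinuous family, so that the theorem of
Arzelà–Ascoli applies. -/
theorem isCompactOperator_convOp (φ : C(G, ℂ)) : IsCompactOperator (convOp μ φ) := by
  let e := ContinuousMap.linearIsometryBoundedOfCompact G ℂ ℂ
  have h : IsCompactOperator fun f => e (convOp μ φ f) := by
    have : IsCompactOperator
        ((e.toContinuousLinearEquiv.toContinuousLinearMap.comp (convOp μ φ)).toLinearMap) := by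
      rw [isCompactOperator_iff_isCompact_closure_image_closedBall _ one_pos]
      refine BoundedContinuousFunction.arzela_ascoli (Metric.closedBall 0 ‖convOp μ φ‖)
        (isCompact_closedBall _ _) _ ?_ ?_
      · rintro _ x ⟨f, hf, rfl⟩
        rw [mem_closedBall_zero_iff] at hf ⊢
        exact ((convOp μ φ f).norm_coe_le_norm x).trans
          ((convOp μ φ).le_of_opNorm_le_of_le le_rfl hf |>.trans (by rw [mul_one]))
      · intro x
        refine Metric.equicontinuousAt_of_continuity_modulus
          (fun y => ‖toL2 (leftTranslate x φ) - toL2 (leftTranslate y φ)‖) ?_ _ ?_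
        · have hc : Continuous fun y => ‖toL2 (leftTranslate x φ) - toL2 (leftTranslate y φ)‖ :=
            (continuous_const.sub ((toL2).continuous.comp (continuous_leftTranslate φ))).norm
          simpa using hc.tendsto x
        · refine Filter.Eventually.of_forall fun y => ?_
          rintro ⟨_, f, hf, rfl⟩
          rw [mem_closedBall_zero_iff] at hf
          rw [dist_eq_norm]
          change ‖⟪toL2 (leftTranslate x φ), f⟫ - ⟪toL2 (leftTranslate y φ), f⟫‖ ≤ _
          rw [← inner_sub_left]
          exact (norm_inner_le_norm _ _).trans (mul_le_of_le_one_right (norm_nonneg _) hf)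
    exact this
  have h2 := h.clm_comp e.symm.toContinuousLinearEquiv.toContinuousLinearMap
  exact h2

/-- The convolution operator as an operator on `L²(G)`. -/
noncomputable def convL2 (φ : C(G, ℂ)) : Lp ℂ 2 μ →L[ℂ] Lp ℂ 2 μ := (toL2).comp (convOp μ φ)

theorem isCompactOperator_convL2 (φ : C(G, ℂ)) : IsCompactOperator (convL2 μ φ) :=
  (isCompactOperator_convOp μ φ).clm_comp toL2

theorem isSymmetric_convL2 [μ.WeaklyRegular] {φ : C(G, ℂ)} (hφ : ∀ x, conj (φ x) = φ x⁻¹) :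
    (convL2 μ φ).IsSymmetric := by
  have hd : DenseRange (toL2) := ContinuousMap.toLp_denseRange ℂ μ ℂ (by simp)
  intro f h
  induction f, h using hd.induction_on₂ with
  | hp =>
    exact isClosed_eq
      (((convL2 μ φ).continuous.comp continuous_fst).inner continuous_snd)
      (continuous_fst.inner ((convL2 μ φ).continuous.comp continuous_snd))
  | h f h =>
    change ⟪toL2 (convOp μ φ (toL2 f)), toL2 h⟫ = ⟪toL2 f, toL2 (convOp μ φ (toL2 h))⟫
    rw [ContinuousMap.inner_toLp, ContinuousMap.inner_toLp]
    simp only [convOp_apply, ContinuousMap.inner_toLp, leftTranslate_apply, ← integral_conj,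
      ← integral_const_mul, ← integral_mul_const]
    rw [integral_integral_swap_of_hasCompactSupport (by fun_prop)
      (HasCompactSupport.of_compactSpace _)]
    congr 1 with y
    congr 1 with x
    rw [map_mul, Complex.conj_conj, hφ, _root_.mul_inv_rev, inv_inv]
    ring

/-! ### Representations on eigenspaces of convolution operators -/

/-- A finite orthonormal family of continuous functions whose span is invariant under left
translations carries a unitary representation. -/
theorem exists_rep_of_orthonormal {n : ℕ} {u : Fin n → C(G, ℂ)}
    (hu : Orthonormal ℂ fun i => toL2 (u i))
    (hinv : ∀ g j, leftTranslate g (u j) =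
      ∑ i, ⟪toL2 (u i), toL2 (leftTranslate g (u j))⟫ • u i) :
    ∃ σ : FinUnitaryRep G, ∀ g, σ.mat g = 1 → ∀ j, leftTranslate g (u j) = u j := by
  let M : G → Matrix (Fin n) (Fin n) ℂ :=
    fun g => Matrix.of fun i j => ⟪toL2 (u i), toL2 (leftTranslate g (u j))⟫
  have hM : ∀ g j, leftTranslate g (u j) = ∑ i, M g i j • u i := hinv
  have hM1 : M 1 = 1 := by
    ext i j
    change ⟪toL2 (u i), toL2 (leftTranslate 1 (u j))⟫ = _
    rw [leftTranslate_one, one_apply]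
    exact orthonormal_iff_ite.1 hu i j
  have hMmul : ∀ g h, M (g * h) = M g * M h := fun g h => by
    ext i j
    change ⟪toL2 (u i), toL2 (leftTranslate (g * h) (u j))⟫ = _
    rw [leftTranslate_mul, hM h, leftTranslate_sum_smul, map_sum, inner_sum, mul_apply]
    refine Finset.sum_congr rfl fun k _ => ?_
    rw [map_smul, inner_smul_right, mul_comm]
    rfl
  have hMU : ∀ g, M g ∈ unitaryGroup (Fin n) ℂ := fun g => by
    rw [mem_unitaryGroup_iff', star_eq_conjTranspose]
    ext i j
    have h := inner_leftTranslate μ g (u i) (u j)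
    rw [hM, hM, map_sum, map_sum] at h
    simp only [map_smul] at h
    rw [hu.inner_sum] at h
    rw [mul_apply, one_apply, ← orthonormal_iff_ite.1 hu i j, ← h]
    rfl
  have hMc : Continuous M := continuous_matrix fun i j =>
    continuous_const.inner ((toL2).continuous.comp (continuous_leftTranslate (u j)))
  refine ⟨{ ι := Fin n
            hom :=
              { toFun := fun g => ⟨M g, hMU g⟩
                map_one' := Subtype.ext hM1
                map_mul' := fun g h => Subtype.ext (hMmul g h) }
            continuous_hom := hMc.subtype_mk _ }, fun g hg j => ?_⟩
  replace hg : M g = 1 := hg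
  rw [hM, hg]
  simp [one_apply, ite_smul]

theorem exists_rep_of_eigenspace (φ : C(G, ℂ)) {c : ℂ} (hc : c ≠ 0) :
    ∃ σ : FinUnitaryRep G, ∀ g, σ.mat g = 1 → ∀ f : C(G, ℂ),
      toL2 f ∈ Module.End.eigenspace (convL2 μ φ).toLinearMap c → leftTranslate g f = f := by
  let E := Module.End.eigenspace (convL2 μ φ).toLinearMap c
  have : FiniteDimensional ℂ E :=
    ContinuousLinearMap.finite_dimensional_eigenspace (isCompactOperator_convL2 μ φ) c hc
  let b := stdOrthonormalBasis ℂ E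
  have hE : ∀ f, f ∈ E ↔ toL2 (convOp μ φ f) = c • f := fun f => Module.End.mem_eigenspace_iff
  -- eigenvectors are represented by continuous functions, as `K` takes values in `C(G)`
  let u : Fin _ → C(G, ℂ) := fun i => c⁻¹ • convOp μ φ (b i)
  have hub : ∀ i, toL2 (u i) = b i := fun i => by
    rw [map_smul, (hE _).1 (b i).2, smul_smul, inv_mul_cancel₀ hc, one_smul]
  have hcoord : ∀ f : C(G, ℂ), toL2 f ∈ E → f = ∑ i, ⟪toL2 (u i), toL2 f⟫ • u i := fun f hf => by
    refine ContinuousMap.toLp_injective (p := 2) (𝕜 := ℂ) μ ?_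
    have h := congrArg Subtype.val (b.sum_repr' ⟨toL2 f, hf⟩)
    rw [map_sum]
    simp only [map_smul, hub]
    simpa using h.symm
  have htr : ∀ g f, toL2 f ∈ E → toL2 (leftTranslate g f) ∈ E := fun g f hf => by
    rw [hE] at hf ⊢
    rw [← map_smul] at hf ⊢
    rw [convOp_leftTranslate, ContinuousMap.toLp_injective (p := 2) (𝕜 := ℂ) μ hf,
      leftTranslate_smul]
  have hortho : Orthonormal ℂ fun i => toL2 (u i) := by
    simp only [hub]
    exact b.orthonormal.comp_linearIsometry E.subtypeₗᵢ
  obtain ⟨σ, hσ⟩ := exists_rep_of_orthonormal μ hortho fun g j =>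
    hcoord _ (htr g _ (by rw [hub]; exact (b j).2))
  refine ⟨σ, fun g hg f hf => ?_⟩
  rw [hcoord f hf, leftTranslate_sum_smul]
  simp only [hσ g hg]

end PeterWeyl

/-! ### Density of the matrix coefficients -/

section MatrixCoefficients

open MeasureTheory

variable {G : Type*} [Group G] [TopologicalSpace G] [IsTopologicalGroup G] [CompactSpace G]
  [T2Space G]

/-- A continuous function `φ` with `conj (φ x) = φ x⁻¹` and `φ 1 = 1` whose support is disjoint
from its translate by `g ≠ 1`. -/
theorem exists_hermitian_bump {g : G} (hg : g ≠ 1) :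
    ∃ φ : C(G, ℂ), φ 1 = 1 ∧ (∀ x, conj (φ x) = φ x⁻¹) ∧ ∀ x, φ (g⁻¹ * x) * conj (φ x) = 0 := by
  have hopen : IsOpen {p : G × G | p.1 * p.2⁻¹ ≠ g⁻¹} :=
    isOpen_ne.preimage (by fun_prop : Continuous fun p : G × G => p.1 * p.2⁻¹)
  obtain ⟨U, V, hU, hV, h1U, h1V, hUV⟩ := isOpen_prod_iff.1 hopen 1 1 (by simpa using hg)
  obtain ⟨f, hf0, hf1, -⟩ := exists_continuous_zero_one_of_isClosed
    ((hU.inter hV).isClosed_compl) (isClosed_singleton (x := (1 : G)))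
    (Set.disjoint_singleton_right.2 fun h => h ⟨h1U, h1V⟩)
  have hf : ∀ x, f x ≠ 0 → x ∈ U ∩ V := fun x hx => by
    by_contra h
    exact hx (hf0 h)
  refine ⟨⟨fun x => ((f x * f x⁻¹ : ℝ) : ℂ), by fun_prop⟩, ?_, fun x => ?_, fun x => ?_⟩
  · have h : f 1 = 1 := hf1 rfl
    simp [h]
  · simp [mul_comm]
  · by_contra h
    simp only [ContinuousMap.coe_mk, Complex.conj_ofReal, ← Complex.ofReal_mul,
      Complex.ofReal_eq_zero, ← ne_eq, mul_ne_zero_iff] at h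
    exact hUV (Set.mk_mem_prod (hf _ h.1.1).1 (hf _ h.2.1).2) (by simp)

/-- The finite-dimensional unitary representations of a compact group separate its points.
Otherwise some `g ≠ 1` fixes all eigenfunctions of all convolution operators for nonzero
eigenvalues, and by the spectral theorem these operators annihilate `f - g • f` for every `f`. -/
theorem exists_mat_ne_one {g : G} (hg : g ≠ 1) : ∃ σ : FinUnitaryRep G, σ.mat g ≠ 1 := by
  by_contra! hall
  let _ : MeasurableSpace G := borel G
  have : BorelSpace G := ⟨rfl⟩
  let μ : Measure G := Measure.haar
  obtain ⟨φ, hφ1, hφ, hφ0⟩ := exists_hermitian_bump hg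
  let L := ContinuousMap.toLp (E := ℂ) 2 μ ℂ
  have hL : Function.Injective L := ContinuousMap.toLp_injective μ
  let v := L φ - L (leftTranslate g φ)
  have hsymm := isSymmetric_convL2 μ hφ
  have hTv : convL2 μ φ v = 0 := by
    have hmem : convL2 μ φ v ∈
        (⨆ c, Module.End.eigenspace (convL2 μ φ).toLinearMap c)ᗮ := by
      rw [← Submodule.iInf_orthogonal, Submodule.mem_iInf]
      intro c
      rw [Submodule.mem_orthogonal]
      intro u hu
      have hu' : L (convOp μ φ u) = c • u := Module.End.mem_eigenspace_iff.1 hu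
      have h1 : inner ℂ u (convL2 μ φ v) = conj c * inner ℂ u v := by
        have h := hsymm u v
        rw [← inner_smul_left, ← hu']
        exact h.symm
      rw [h1]
      by_cases hc : c = 0
      · simp [hc]
      · obtain ⟨σ, hσ⟩ := exists_rep_of_eigenspace μ φ hc
        have huf : L (c⁻¹ • convOp μ φ u) = u := by
          rw [map_smul, hu', smul_smul, inv_mul_cancel₀ hc, one_smul]
        have hfix := hσ g (hall σ) (c⁻¹ • convOp μ φ u) (by rw [← huf] at hu; exact hu)
        have h2 := inner_leftTranslate μ g (c⁻¹ • convOp μ φ u) φ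
        rw [hfix] at h2
        change inner ℂ (L _) (L _) = inner ℂ (L _) (L _) at h2
        rw [huf] at h2
        rw [inner_sub_right, h2, sub_self, mul_zero]
    rwa [ContinuousLinearMap.orthogonalComplement_iSup_eigenspaces_eq_bot
      (isCompactOperator_convL2 μ φ) hsymm, Submodule.mem_bot] at hmem
  have hKv : convOp μ φ v = 0 := hL (by rw [map_zero]; exact hTv)
  have h := congrArg (fun f : C(G, ℂ) => f 1) hKv
  simp only [ContinuousMap.zero_apply, convOp_apply, leftTranslate_one, v] at h
  have h0 : inner ℂ (L φ) (L (leftTranslate g φ)) = 0 := by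
    rw [ContinuousMap.inner_toLp]
    simp only [leftTranslate_apply, hφ0, integral_zero]
  change inner ℂ (L φ) _ = 0 at h
  rw [inner_sub_right, h0, sub_zero, inner_self_eq_zero, ← map_zero L] at h
  have := hL h
  rw [this] at hφ1
  simp at hφ1

variable (G) in
/-- The star-algebra of matrix coefficients `g ↦ tr(C σ_g)` of finite-dimensional unitary
representations. -/
noncomputable def matrixCoefficients : StarSubalgebra ℂ C(G, ℂ) where
  carrier := {p | ∃ (σ : FinUnitaryRep G) (C : Matrix σ.ι σ.ι ℂ), ∀ g, p g = trace (C * σ.mat g)}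
  mul_mem' := by
    rintro p q ⟨σ, C, hp⟩ ⟨τ, D, hq⟩
    refine ⟨σ.tensor τ, C ⊗ₖ D, fun g => ?_⟩
    rw [FinUnitaryRep.tensor_mat, ← mul_kronecker_mul, trace_kronecker, ContinuousMap.mul_apply,
      hp, hq]
  add_mem' := by
    rintro p q ⟨σ, C, hp⟩ ⟨τ, D, hq⟩
    refine ⟨σ.directSum τ, fromBlocks C 0 0 D, fun g => ?_⟩
    rw [FinUnitaryRep.directSum_mat, fromBlocks_multiply]
    simp [hp, hq, trace, Fintype.sum_sum_type]
  algebraMap_mem' c := by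
    refine ⟨{ ι := Unit, hom := 1, continuous_hom := continuous_const }, c • 1, fun g => ?_⟩
    simp [FinUnitaryRep.mat]
  star_mem' := by
    rintro p ⟨σ, C, hp⟩
    refine ⟨σ.conjRep, C.map (starRingEnd ℂ), fun g => ?_⟩
    rw [FinUnitaryRep.conjRep_mat, ← Matrix.map_mul, ContinuousMap.star_apply, hp]
    exact AddMonoidHom.map_trace (starRingEnd ℂ : ℂ →+* ℂ).toAddMonoidHom _

/-- The **Peter–Weyl theorem**: the matrix coefficients are uniformly dense in `C(G)`. -/
theorem exists_matrixCoefficient_near (f : C(G, ℂ)) {ε : ℝ} (hε : 0 < ε) :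
    ∃ (σ : FinUnitaryRep G) (C : Matrix σ.ι σ.ι ℂ), ∀ g, ‖f g - trace (C * σ.mat g)‖ < ε := by
  have hsep : (matrixCoefficients G).SeparatesPoints := by
    intro x y hxy
    obtain ⟨σ, hσ⟩ := exists_mat_ne_one (g := x⁻¹ * y) fun h => hxy (inv_mul_eq_one.1 h)
    have hne : σ.mat x ≠ σ.mat y := fun h => hσ (by
      rw [σ.mat_mul, ← h, σ.mat_inv, σ.conjTranspose_mat_mul_mat])
    obtain ⟨i, j, hij⟩ : ∃ i j, σ.mat x i j ≠ σ.mat y i j := by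
      by_contra! h
      exact hne (by ext i j; exact h i j)
    refine ⟨_, ⟨⟨fun g => σ.mat g i j, σ.continuous_mat.matrix_elem i j⟩,
      ⟨σ, single j i 1, fun g => ?_⟩, rfl⟩, hij⟩
    simp [trace_single_mul]
  have htop := ContinuousMap.starSubalgebra_topologicalClosure_eq_top_of_separatesPoints _ hsep
  have hf : f ∈ closure (matrixCoefficients G : Set C(G, ℂ)) := by
    rw [← StarSubalgebra.topologicalClosure_coe, htop]
    trivial
  obtain ⟨p, ⟨σ, C, hp⟩, hfp⟩ := Metric.mem_closure_iff.1 hf ε hε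
  refine ⟨σ, C, fun g => ?_⟩
  rw [← hp, ← dist_eq_norm]
  exact (ContinuousMap.dist_apply_le_dist g).trans_lt hfp

end MatrixCoefficients

/-! ### Averages over the group -/

section Averages

open MeasureTheory

namespace CStarAction

variable {G : Type*} [Group G] [TopologicalSpace G] {A : Type*} [CStarAlgebra A]
  (α : CStarAction G A)

theorem continuous_orbit (a : A) : Continuous fun g => α.toHom g a :=
  α.continuous_act.comp (continuous_id.prodMk continuous_const)

theorem continuous_apply (g : G) : Continuous fun a => α.toHom g a :=
  α.continuous_act.comp (continuous_const.prodMk continuous_id)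

theorem norm_apply (g : G) (a : A) : ‖α.toHom g a‖ = ‖a‖ := StarAlgEquiv.norm_map (α.toHom g) a

/-- The automorphism `α_g` as a continuous linear map. -/
def toCLM (g : G) : A →L[ℂ] A where
  toFun a := α.toHom g a
  map_add' := map_add _
  map_smul' := map_smul _
  cont := α.continuous_apply g

variable [MeasurableSpace G] (μ : Measure G)

/-- The matrix `∫ σ_g ⊗ α_g(a) dg`. -/
noncomputable def coeffAverage (σ : FinUnitaryRep G) (a : A) : Matrix σ.ι σ.ι A :=
  Matrix.of fun i j => ∫ g, σ.mat g i j • α.toHom g a ∂μ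

variable [BorelSpace G] [CompactSpace G] [IsFiniteMeasureOnCompacts μ]

theorem integrable_smul_orbit (a : A) {f : G → ℂ} (hf : Continuous f) :
    Integrable (fun g => f g • α.toHom g a) μ :=
  (hf.smul (α.continuous_orbit a)).integrable_of_hasCompactSupport
    (HasCompactSupport.of_compactSpace _)

theorem coeffAverage_equivariant [IsTopologicalGroup G] [μ.IsMulLeftInvariant]
    (σ : FinUnitaryRep G) (a : A) (h : G) :
    (α.coeffAverage μ σ a).map (α.toHom h) =
      (σ.mat h)ᴴ.map (algebraMap ℂ A) * α.coeffAverage μ σ a := by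
  ext i j
  have hc : ∀ k, Continuous fun g => σ.mat g k j := fun k => σ.continuous_mat.matrix_elem k j
  calc α.toHom h (∫ g, σ.mat g i j • α.toHom g a ∂μ)
      = ∫ g, α.toCLM h (σ.mat g i j • α.toHom g a) ∂μ :=
        ((α.toCLM h).integral_comp_comm (α.integrable_smul_orbit μ a (hc i))).symm
    _ = ∫ g, σ.mat (h⁻¹ * (h * g)) i j • α.toHom (h * g) a ∂μ := by
        congr 1 with g
        rw [map_smul, inv_mul_cancel_left, _root_.map_mul]
        rfl
    _ = ∫ g, σ.mat (h⁻¹ * g) i j • α.toHom g a ∂μ :=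
        integral_mul_left_eq_self (fun g => σ.mat (h⁻¹ * g) i j • α.toHom g a) h
    _ = ∫ g, ∑ k, (σ.mat h)ᴴ i k • (σ.mat g k j • α.toHom g a) ∂μ := by
        congr 1 with g
        rw [σ.mat_mul, σ.mat_inv, mul_apply, Finset.sum_smul]
        simp only [smul_smul]
    _ = ((σ.mat h)ᴴ.map (algebraMap ℂ A) * α.coeffAverage μ σ a) i j := by
        rw [integral_finsetSum _ fun k _ => (α.integrable_smul_orbit μ a (hc k)).fun_smul _, mul_apply]
        refine Finset.sum_congr rfl fun k _ => ?_
        rw [integral_smul, map_apply, ← Algebra.smul_def]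
        rfl

end CStarAction

namespace IsometrySystem

variable {G : Type*} [Group G] [TopologicalSpace G] [CompactSpace G]
  {A : Type*} [CStarAlgebra A] {α : CStarAction G A} {I : IrrepSystem G}
  (S : IsometrySystem α I) (dec : ∀ σ : FinUnitaryRep G, Decomposition I σ)

section

variable [MeasurableSpace G] [BorelSpace G] (μ : Measure G) [IsFiniteMeasureOnCompacts μ]

theorem a_coeffAverage (σ : FinUnitaryRep G) (C : Matrix σ.ι σ.ι ℂ) (a : A) :
    S.a dec σ (S.ext (dec σ) * (α.coeffAverage μ σ a * C.map (algebraMap ℂ A))) =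
      ∫ g, trace (C * σ.mat g) • α.toHom g a ∂μ := by
  have hi : ∀ i j, Integrable (fun g => C i j • (σ.mat g j i • α.toHom g a)) μ := fun i j =>
    (α.integrable_smul_orbit μ a (σ.continuous_mat.matrix_elem j i)).fun_smul _
  rw [IsometrySystem.a, ← Matrix.mul_assoc, ext_isometry, Matrix.one_mul,
    trace_mul_map_algebraMap]
  simp only [trace, diag, mul_apply, Finset.sum_smul, mul_smul]
  rw [integral_finsetSum _ fun i _ => integrable_finsetSum _ fun j _ => hi i j]
  refine Finset.sum_congr rfl fun i _ => ?_
  rw [integral_finsetSum _ fun j _ => hi i j]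
  refine Finset.sum_congr rfl fun j _ => ?_
  rw [integral_smul, map_apply, ← Algebra.smul_def]
  rfl

theorem ext_mul_coeffAverage_mem_fixed [IsTopologicalGroup G] [μ.IsMulLeftInvariant] (σ : FinUnitaryRep G)
    (C : Matrix σ.ι σ.ι ℂ) (a : A) (k : S.Hι (dec σ)) (i : σ.ι) :
    (S.ext (dec σ) * (α.coeffAverage μ σ a * C.map (algebraMap ℂ A))) k i ∈ α.fixed := by
  refine α.mem_fixed_of_map_eq (fun g => ?_) k i
  rw [α.map_mul, α.map_mul, α.map_algebraMap, α.coeffAverage_equivariant, ext_equivariant,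
    Matrix.mul_assoc, Matrix.mul_assoc, ← Matrix.mul_assoc (Matrix.map _ _) (Matrix.map _ _),
    ← map_algebraMap_mul, σ.mat_mul_conjTranspose_mat, map_algebraMap_one, Matrix.one_mul]

end

variable [IsTopologicalGroup G]

/-- The elements `a_σ(x)`, with `x` a matrix over the fixed point algebra, are dense: `a` is
approximated by `∫ f(g) α_g(a) dg` with `f` concentrated near `1`, and `f` by a matrix
coefficient. -/
theorem exists_a_near [T2Space G] (a : A) {ε : ℝ} (hε : 0 < ε) :
    ∃ (σ : FinUnitaryRep G) (x : Matrix (S.Hι (dec σ)) σ.ι A),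
      (∀ k i, x k i ∈ α.fixed) ∧ ‖a - S.a dec σ x‖ < ε := by
  let _ : MeasurableSpace G := borel G
  have : BorelSpace G := ⟨rfl⟩
  let μ : Measure G := Measure.haarMeasure ⊤
  have hμ : IsProbabilityMeasure μ := ⟨Measure.haarMeasure_self⟩
  have hU : IsOpen {g | ‖a - α.toHom g a‖ < ε / 2} :=
    isOpen_lt (continuous_const.sub (α.continuous_orbit a)).norm continuous_const
  obtain ⟨f, hf0, hf1, hf⟩ := exists_continuous_zero_one_of_isClosed
    hU.isClosed_compl (isClosed_singleton (x := (1 : G)))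
    (Set.disjoint_singleton_right.2 fun h => h (by simpa using half_pos hε))
  have hfi : Integrable (fun g => f g) μ :=
    f.continuous.integrable_of_hasCompactSupport (HasCompactSupport.of_compactSpace _)
  have hpos : 0 < ∫ g, f g ∂μ :=
    f.continuous.integral_pos_of_hasCompactSupport_nonneg_nonzero
      (HasCompactSupport.of_compactSpace _) (fun g => (hf g).1) (x := 1) (by simp [hf1 rfl])
  let r : G → ℝ := fun g => (∫ g, f g ∂μ)⁻¹ * f g
  have hr0 : ∀ g, 0 ≤ r g := fun g => mul_nonneg (inv_nonneg.2 hpos.le) (hf g).1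
  have hrc : Continuous r := by fun_prop
  have hr1 : ∫ g, r g ∂μ = 1 := by
    rw [integral_const_mul, inv_mul_cancel₀ hpos.ne']
  have hri : Integrable r μ := hfi.const_mul _
  obtain ⟨σ, C, hC⟩ := exists_matrixCoefficient_near (G := G) ⟨fun g => (r g : ℂ), by fun_prop⟩
    (show 0 < ε / (2 * (‖a‖ + 1)) by positivity)
  refine ⟨σ, _, S.ext_mul_coeffAverage_mem_fixed dec μ σ C a, ?_⟩
  rw [a_coeffAverage]
  have hrC : Continuous fun g => (r g : ℂ) := by fun_prop
  have htC : Continuous fun g => trace (C * σ.mat g) :=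
    (continuous_const.matrix_mul σ.continuous_mat).matrix_trace
  have h1 : ‖a - ∫ g, (r g : ℂ) • α.toHom g a ∂μ‖ ≤ ε / 2 := by
    have hconst : a = ∫ g, (r g : ℂ) • a ∂μ := by
      rw [integral_smul_const, integral_complex_ofReal, hr1, Complex.ofReal_one, one_smul]
    have hint : Integrable (fun g => (r g : ℂ) • a) μ := hri.ofReal.smul_const a
    calc ‖a - ∫ g, (r g : ℂ) • α.toHom g a ∂μ‖
        = ‖∫ g, ((r g : ℂ) • a - (r g : ℂ) • α.toHom g a) ∂μ‖ := by
          rw [integral_sub hint (α.integrable_smul_orbit μ a hrC), ← hconst]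
      _ ≤ ∫ g, r g * (ε / 2) ∂μ := by
          refine norm_integral_le_of_norm_le (hri.mul_const _) (Filter.Eventually.of_forall ?_)
          intro g
          rw [← smul_sub, norm_smul, Complex.norm_real, Real.norm_of_nonneg (hr0 g)]
          by_cases hg : ‖a - α.toHom g a‖ < ε / 2
          · exact mul_le_mul_of_nonneg_left hg.le (hr0 g)
          · have h0 : f g = 0 := hf0 hg
            simp [r, h0]
      _ = ε / 2 := by rw [integral_mul_const, hr1, one_mul]
  have h2 : ‖(∫ g, (r g : ℂ) • α.toHom g a ∂μ) - ∫ g, trace (C * σ.mat g) • α.toHom g a ∂μ‖ <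
      ε / 2 := by
    rw [← integral_sub (α.integrable_smul_orbit μ a hrC) (α.integrable_smul_orbit μ a htC)]
    have hle : ∀ g, ‖(r g : ℂ) • α.toHom g a - trace (C * σ.mat g) • α.toHom g a‖ ≤
        ε / (2 * (‖a‖ + 1)) * ‖a‖ := fun g => by
      rw [← sub_smul, norm_smul, α.norm_apply]
      exact mul_le_mul_of_nonneg_right (hC g).le (norm_nonneg _)
    refine (norm_integral_le_of_norm_le_const (Filter.Eventually.of_forall hle)).trans_lt ?_
    rw [probReal_univ, mul_one, div_mul_eq_mul_div, div_lt_div_iff₀ (by positivity) two_pos]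
    nlinarith [norm_nonneg a]
  calc _ ≤ _ := norm_sub_le_norm_sub_add_norm_sub _ (∫ g, (r g : ℂ) • α.toHom g a ∂μ) _
    _ < ε / 2 + ε / 2 := add_lt_add_of_le_of_lt h1 h2
    _ = ε := add_halves ε

/-- An invariant element `a_σ(x)` with `x` over `B` belongs to `B`: averaging over `G` replaces
`σ_g` by a matrix whose columns are invariant vectors. -/
theorem a_mem_of_mem_fixed {B : StarSubalgebra ℂ A} (hB : B ≤ α.fixed) (σ : FinUnitaryRep G)
    {x : Matrix (S.Hι (dec σ)) σ.ι A} (hx : ∀ k i, x k i ∈ B) (h : S.a dec σ x ∈ α.fixed) :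
    S.a dec σ x ∈ B := by
  let _ : MeasurableSpace G := borel G
  have : BorelSpace G := ⟨rfl⟩
  let μ : Measure G := Measure.haarMeasure ⊤
  have hμ : IsProbabilityMeasure μ := ⟨Measure.haarMeasure_self⟩
  have hc : ∀ i j, Continuous fun g => σ.mat g i j := fun i j =>
    σ.continuous_mat.matrix_elem i j
  have hint : ∀ i j, Integrable (fun g => σ.mat g i j) μ := fun i j =>
    (hc i j).integrable_of_hasCompactSupport (HasCompactSupport.of_compactSpace _)
  let P : Matrix σ.ι σ.ι ℂ := Matrix.of fun i j => ∫ g, σ.mat g i j ∂μ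
  have hP : ∀ j g, σ.mat g *ᵥ (fun i => P i j) = fun i => P i j := fun j g => by
    ext i
    calc (∑ k, σ.mat g i k * ∫ h, σ.mat h k j ∂μ) = ∫ h, σ.mat (g * h) i j ∂μ := by
          simp only [← integral_const_mul]
          rw [← integral_finsetSum _ fun k _ => (hint k j).const_mul _]
          simp only [σ.mat_mul, mul_apply]
      _ = ∫ h, σ.mat h i j ∂μ := integral_mul_left_eq_self (fun h => σ.mat h i j) g
  have key : S.a dec σ x = trace ((S.ext (dec σ) * P.map (algebraMap ℂ A))ᴴ * x) := by
    have hX : ∀ i j, Integrable (fun g => conj (σ.mat g i j) • ((S.ext (dec σ))ᴴ * x) i j) μ :=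
      fun i j => ((Complex.continuous_conj.comp (hc i j)).smul
        continuous_const).integrable_of_hasCompactSupport (HasCompactSupport.of_compactSpace _)
    calc S.a dec σ x = ∫ _, S.a dec σ x ∂μ := by simp
      _ = ∫ g, ∑ i, ∑ j, conj (σ.mat g i j) • ((S.ext (dec σ))ᴴ * x) i j ∂μ := by
          congr 1 with g
          conv_lhs => rw [← h g, S.act_a dec g σ fun k i => hB (hx k i), IsometrySystem.a,
            ← Matrix.mul_assoc, trace_mul_conjTranspose_map_algebraMap]
      _ = ∑ i, ∑ j, conj (P i j) • ((S.ext (dec σ))ᴴ * x) i j := by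
          rw [integral_finsetSum _ fun i _ => integrable_finsetSum _ fun j _ => hX i j]
          refine Finset.sum_congr rfl fun i _ => ?_
          rw [integral_finsetSum _ fun j _ => hX i j]
          refine Finset.sum_congr rfl fun j _ => ?_
          rw [integral_smul_const, integral_conj]
          rfl
      _ = trace ((S.ext (dec σ) * P.map (algebraMap ℂ A))ᴴ * x) := by
          rw [conjTranspose_mul, conjTranspose_map_algebraMap, Matrix.mul_assoc,
            ← trace_mul_map_algebraMap, trace_mul_conjTranspose_map_algebraMap]
  rw [key]
  refine B.trace_mem (B.matrix_mul_mem (B.matrix_conjTranspose_mem fun m j => ?_) hx)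
  exact S.ext_mulVec_of_invariant_mem B (dec σ) (hP j) m

end IsometrySystem

end Averages

/-! ### The dense subalgebra -/

namespace IsometrySystem

variable {G : Type*} [Group G] [TopologicalSpace G] {A : Type*} [CStarAlgebra A]
  {α : CStarAction G A} {I : IrrepSystem G}
  (S : IsometrySystem α I) (dec : ∀ σ : FinUnitaryRep G, Decomposition I σ)

theorem a_add (σ : FinUnitaryRep G) (x y : Matrix (S.Hι (dec σ)) σ.ι A) :
    S.a dec σ (x + y) = S.a dec σ x + S.a dec σ y := by
  rw [a, Matrix.mul_add, trace_add]
  rfl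

theorem continuous_a (σ : FinUnitaryRep G) : Continuous (S.a dec σ) :=
  (continuous_const.matrix_mul continuous_id).matrix_trace

theorem a_eq_sum_tens (σ : FinUnitaryRep G) (x : Matrix (S.Hι (dec σ)) σ.ι A) :
    S.a dec σ x = ∑ i, S.a dec σ (tens (fun k => x k i) (Pi.single i 1)) := by
  refine Finset.sum_congr rfl fun i _ => ?_
  rw [a_tens, Finset.sum_eq_single i]
  · simp only [Pi.single_eq_same, one_smul]
    rfl
  · intro j _ hj
    simp [hj]
  · simp

theorem a_eq_sum_simple (σ : FinUnitaryRep G) (x : Matrix (S.Hι (dec σ)) σ.ι A) :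
    S.a dec σ x = ∑ i, ∑ k,
      S.a dec σ (tens (simpleVec (x k i) (Pi.single k 1)) (Pi.single i 1)) := by
  rw [a_eq_sum_tens]
  refine Finset.sum_congr rfl fun i _ => ?_
  have h : (fun k => x k i) = ∑ k, simpleVec (x k i) (Pi.single k 1) := by
    ext k
    rw [Finset.sum_apply, Finset.sum_eq_single k]
    · simp [simpleVec]
    · intro j _ hj
      simp [simpleVec, hj.symm]
    · simp
  simp only [a_tens]
  rw [h, Finset.sum_comm]
  refine Finset.sum_congr rfl fun j _ => ?_
  rw [mulVec_sum, Finset.sum_apply, Finset.smul_sum]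

variable {S dec} {B : StarSubalgebra ℂ A}

/-- Along an isometric intertwiner `σ → ρ`, every `a_σ(x)` is of the form `a_ρ(x')`. -/
theorem IsCompatible.exists_a_eq (hB : S.IsCompatible dec B) {σ ρ : FinUnitaryRep G}
    {T : Matrix ρ.ι σ.ι ℂ} (hT : FinUnitaryRep.IsIntertwiner σ ρ T) (hT1 : Tᴴ * T = 1)
    {x : Matrix (S.Hι (dec σ)) σ.ι A} (hx : ∀ k i, x k i ∈ B) :
    ∃ x' : Matrix (S.Hι (dec ρ)) ρ.ι A, (∀ k i, x' k i ∈ B) ∧ S.a dec σ x = S.a dec ρ x' := by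
  refine ⟨S.ext (dec ρ) * T.map (algebraMap ℂ A) * (S.ext (dec σ))ᴴ *
    (x * Tᴴ.map (algebraMap ℂ A)), ?_, ?_⟩
  · exact B.matrix_mul_mem (hB.ext_mul_ext_mem _ _ hT)
      (B.matrix_mul_mem hx fun i j => algebraMap_mem B _)
  · rw [a, a, ← Matrix.mul_assoc, ← Matrix.mul_assoc, ← Matrix.mul_assoc, ← Matrix.mul_assoc,
      ext_isometry, Matrix.one_mul, trace_mul_map_algebraMap, Matrix.mul_assoc, ← Matrix.mul_assoc,
      ← map_algebraMap_mul, hT1, map_algebraMap_one, Matrix.one_mul]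

/-- The set of all `a_σ(x)` with `x` over a compatible subalgebra `B`; sums are formed in the direct
sum of representations. -/
noncomputable def IsCompatible.coeffSpan (hB : S.IsCompatible dec B) : AddSubmonoid A where
  carrier := {z | ∃ (σ : FinUnitaryRep G) (x : Matrix (S.Hι (dec σ)) σ.ι A),
    (∀ k i, x k i ∈ B) ∧ z = S.a dec σ x}
  add_mem' := by
    rintro _ _ ⟨σ, x, hx, rfl⟩ ⟨τ, y, hy, rfl⟩
    have hl : FinUnitaryRep.IsIntertwiner σ (σ.directSum τ) (fromRows 1 0) := fun g => by
      rw [FinUnitaryRep.directSum_mat, fromRows_mul, fromBlocks_mul_fromRows]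
      simp
    have hr : FinUnitaryRep.IsIntertwiner τ (σ.directSum τ) (fromRows 0 1) := fun g => by
      rw [FinUnitaryRep.directSum_mat, fromRows_mul, fromBlocks_mul_fromRows]
      simp
    obtain ⟨x', hx', hx''⟩ := hB.exists_a_eq hl
      (by simp [conjTranspose_fromRows_eq_fromCols_conjTranspose, fromCols_mul_fromRows]) hx
    obtain ⟨y', hy', hy''⟩ := hB.exists_a_eq hr
      (by simp [conjTranspose_fromRows_eq_fromCols_conjTranspose, fromCols_mul_fromRows]) hy
    exact ⟨σ.directSum τ, x' + y', fun k i => add_mem (hx' k i) (hy' k i),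
      by rw [a_add, hx'', hy'']⟩
  zero_mem' := ⟨I.rep I.one, 0, fun _ _ => zero_mem B, by simp [a]⟩

theorem IsCompatible.a_mem_coeffSpan (hB : S.IsCompatible dec B) {σ : FinUnitaryRep G}
    {x : Matrix (S.Hι (dec σ)) σ.ι A} (hx : ∀ k i, x k i ∈ B) : S.a dec σ x ∈ hB.coeffSpan :=
  ⟨σ, x, hx, rfl⟩

/-- `b ∈ B` is obtained from the trivial representation, whose isometry is scalar. -/
theorem IsCompatible.mem_coeffSpan (hB : S.IsCompatible dec B) {b : A} (hb : b ∈ B) :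
    b ∈ hB.coeffSpan := by
  let o := I.rep I.one
  have hs : ∀ m v, S.ext (dec o) m v ∈ B := fun m v => by
    have h := S.ext_mulVec_of_invariant_mem B (dec o) (u := Pi.single v 1)
      (fun g => by rw [I.mat_one, one_mulVec]) m
    convert h using 1
    rw [mulVec, dotProduct, Finset.sum_eq_single v]
    · simp
    · intro w _ hw
      simp [hw]
    · simp
  have hb' : b = S.a dec o (S.ext (dec o) * (diagonal fun _ => b : Matrix o.ι o.ι A)) := by
    rw [a, ← Matrix.mul_assoc, ext_isometry, Matrix.one_mul, trace_diagonal, Finset.sum_const,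
      Finset.card_univ, I.card_one, one_smul]
  rw [hb']
  refine hB.a_mem_coeffSpan (B.matrix_mul_mem hs fun i j => ?_)
  rw [diagonal_apply]
  split_ifs
  · exact hb
  · exact zero_mem B

theorem IsCompatible.simple_mem (hB : S.IsCompatible dec B) {σ : FinUnitaryRep G}
    {y : S.Hι (dec σ) → A} (hy : ∀ k, y k ∈ B) (w : σ.ι → ℂ) :
    S.a dec σ (tens y w) ∈ hB.coeffSpan :=
  hB.a_mem_coeffSpan fun k i => B.smul_mem (hy k) (w i)

/-- The star-algebra of all `a_σ(x)` with `x` over a compatible subalgebra `B`. -/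
noncomputable def IsCompatible.coeffAlgebra (hB : S.IsCompatible dec B) : StarSubalgebra ℂ A where
  carrier := hB.coeffSpan
  add_mem' := add_mem
  algebraMap_mem' r := hB.mem_coeffSpan (algebraMap_mem B r)
  mul_mem' := by
    rintro _ _ ⟨σ, x, hx, rfl⟩ ⟨τ, y, hy, rfl⟩
    rw [a_eq_sum_simple, a_eq_sum_simple]
    simp only [Finset.sum_mul, Finset.mul_sum]
    refine sum_mem fun i _ => sum_mem fun k _ => sum_mem fun j _ => sum_mem fun l _ => ?_
    rw [a_mul_a]
    exact hB.simple_mem (hB.mulArg_mem σ τ (hx _ _) (hy _ _) _ _) _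
  star_mem' := by
    rintro _ ⟨σ, x, hx, rfl⟩
    rw [a_eq_sum_tens, star_sum]
    refine sum_mem fun i _ => ?_
    rw [← star_star (Pi.single i 1 : σ.ι → ℂ), star_a]
    exact hB.simple_mem (hB.J_mem σ fun k => hx k i) _

theorem IsCompatible.dense_coeffAlgebra [IsTopologicalGroup G] [CompactSpace G] [T2Space G]
    (hB : S.IsCompatible dec B) (hd : (α.fixed : Set A) ⊆ closure (B : Set A)) :
    Dense (hB.coeffAlgebra : Set A) := by
  rw [← dense_closure]
  refine Metric.dense_iff.2 fun z ε hε => ?_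
  obtain ⟨σ, x, hx, hzx⟩ := S.exists_a_near dec z hε
  refine ⟨S.a dec σ x, by rwa [Metric.mem_ball, dist_comm, dist_eq_norm], ?_⟩
  let C : Set (S.Hι (dec σ) → σ.ι → A) :=
    Set.pi Set.univ fun _ => Set.pi Set.univ fun _ => (B : Set A)
  have hmem : x ∈ closure C := by
    rw [closure_pi_set]
    refine fun k _ => ?_
    rw [closure_pi_set]
    exact fun i _ => hd (hx k i)
  have hC : S.a dec σ '' C ⊆ hB.coeffAlgebra := by
    rintro _ ⟨y, hy, rfl⟩
    exact hB.a_mem_coeffSpan fun k i => hy k trivial i trivial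
  exact closure_mono hC
    (image_closure_subset_closure_image (S.continuous_a dec σ) ⟨x, hmem, rfl⟩)

end IsometrySystem

theorem theorem5p3 {G : Type*} [Group G] [TopologicalSpace G] [IsTopologicalGroup G]
    [CompactSpace G] [T2Space G] {A : Type*} [CStarAlgebra A] (α : CStarAction G A)
    (I : IrrepSystem G) (S : IsometrySystem α I)
    (dec : ∀ σ : FinUnitaryRep G, Decomposition I σ)
    (B₀ : StarSubalgebra ℂ A) (hB₀ : B₀ ≤ α.fixed)
    (hdense : (α.fixed : Set A) ⊆ closure (B₀ : Set A))
    (hγ : ∀ i, ∀ b ∈ B₀, ∀ k l, coact (S.s i) b k l ∈ B₀)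
    (hω : ∀ i j, ∀ m p, S.ωIrr dec i j m p ∈ B₀) :
    ∃ A₀ : StarSubalgebra ℂ A,
      (A₀ : Set A) = {z | ∃ (σ : FinUnitaryRep G) (x : Matrix (S.Hι (dec σ)) σ.ι A),
        (∀ k i, x k i ∈ B₀) ∧ z = S.a dec σ x} ∧
      Dense (A₀ : Set A) ∧
      (∀ g, ∀ z ∈ A₀, α.toHom g z ∈ A₀) ∧
      A₀ ⊓ α.fixed = B₀ ∧
      -- the action
      (∀ (g : G) (σ : FinUnitaryRep G), ∀ b ∈ α.fixed, ∀ (η : S.Hι (dec σ) → ℂ) (v : σ.ι → ℂ),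
        α.toHom g (S.a dec σ (tens (simpleVec b η) (star v))) =
          S.a dec σ (tens (simpleVec b η) (σ.conjRep.mat g *ᵥ star v))) ∧
      -- the multiplication
      (∀ σ τ : FinUnitaryRep G, ∀ b ∈ α.fixed, ∀ c ∈ α.fixed,
        ∀ (η : S.Hι (dec σ) → ℂ) (ϑ : S.Hι (dec τ) → ℂ) (v : σ.ι → ℂ) (w : τ.ι → ℂ),
        S.a dec σ (tens (simpleVec b η) (star v)) * S.a dec τ (tens (simpleVec c ϑ) (star w)) =
          S.a dec (σ.tensor τ) (tens (S.mulArg dec σ τ b c η ϑ)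
            (fun p : σ.ι × τ.ι => star (v p.1) * star (w p.2))) ∧
        (∀ m, S.mulArg dec σ τ b c η ϑ m ∈ α.fixed) ∧
        (b ∈ B₀ → c ∈ B₀ → ∀ m, S.mulArg dec σ τ b c η ϑ m ∈ B₀)) ∧
      -- the involution
      (∀ (σ : FinUnitaryRep G) (x : S.Hι (dec σ) → A), (∀ k, x k ∈ α.fixed) →
        (∀ v : σ.ι → ℂ, star (S.a dec σ (tens x (star v))) =
          S.a dec σ.conjRep (tens (S.J dec σ x) v)) ∧
        (∀ l, S.J dec σ x l ∈ α.fixed) ∧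
        ((∀ k, x k ∈ B₀) → ∀ l, S.J dec σ x l ∈ B₀)) 
  := by
  have hB : S.IsCompatible dec B₀ := ⟨hγ, hω⟩
  have hF : S.IsCompatible dec α.fixed := S.isCompatible_fixed dec
  refine ⟨hB.coeffAlgebra, rfl, hB.dense_coeffAlgebra hdense, ?_, ?_, ?_, ?_, ?_⟩
  · rintro g _ ⟨σ, x, hx, rfl⟩
    rw [S.act_a dec g σ fun k i => hB₀ (hx k i)]
    exact hB.a_mem_coeffSpan (B₀.matrix_mul_mem hx fun i j => algebraMap_mem B₀ _)
  · refine le_antisymm ?_ fun b hb => ⟨hB.mem_coeffSpan hb, hB₀ hb⟩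
    rintro _ ⟨⟨σ, x, hx, rfl⟩, hfix⟩
    exact S.a_mem_of_mem_fixed dec hB₀ σ hx hfix
  · intro g σ b hb η v
    have hfix : ∀ k i, tens (simpleVec b η) (star v) k i ∈ α.fixed := fun k i =>
      α.fixed.smul_mem (α.fixed.smul_mem hb _) _
    rw [S.act_a dec g σ hfix, IsometrySystem.tens_mul_conjTranspose]
  · intro σ τ b hb c hc η ϑ v w
    exact ⟨S.a_mul_a dec σ τ b c η ϑ (star v) (star w), hF.mulArg_mem σ τ hb hc η ϑ,
      fun hb' hc' => hB.mulArg_mem σ τ hb' hc' η ϑ⟩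
  · intro σ x hx
    exact ⟨S.star_a dec σ x, hF.J_mem σ hx, fun hx' => hB.J_mem σ hx'⟩
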